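/- Let $\mathcal{O}_K$ be a Henselian discrete valuation ring with fraction field $K$, uniformiser $t$, normalised valuation $\nu$ and algebraically closed residue field $k=\mathcal{O}_K/t\mathcal{O}_K$. For a polynomial $f$ over $\mathcal{O}_K$ let $\tilde f$ be its image over $k$, and let $\nu(f)$ be the minimum of the valuations of its coefficients. Let $F,G\in\mathcal{O}_K[x_1,x_2,x_3,x_4]$ be quadratic forms such that $\tilde F$ and $\tilde G$ have no common factor, and let $\mathcal{C}=\{F=G=0\}\subset\mathbb{P}^3_{\mathcal{O}_K}$, with generic fibre $\mathcal{C}_K$ and special fibre $\mathcal{C}_k$. Assume that $\mathcal{C}_K$ is smooth over $K$. The multiplicity of an irreducible component $\Gamma$ of $\mathcal{C}_k$ is the length of the local ring of $\mathcal{C}_k$ at the generic point of $\Gamma$, and $\mathcal{C}$ is said to be normal at $\Gamma$ if the local ring of $\mathcal{C}$ at the generic point of $\Gamma$ is an integrally closed domain. (i) If $\Gamma$ is an irreducible component of $\mathcal{C}_k$ of multiplicity $1$, then $\mathcal{C}$ is normal at $\Gamma$. (ii) If $\tilde F=x_1x_3$ and $\tilde G=x_2^2+x_1x_4$ (conic and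 double line), then $\mathcal{C}$ is normal if and only if $$\nu\bigl(x_4F(0,0,x_3,x_4)-x_3G(0,0,x_3,x_4)\bigr)=1.$$ (iii) If $\tilde F=x_1^2$ and $\tilde G=x_2^2+x_3x_4$ (double conic), then $\mathcal{C}$ is normal if and only if there is no $\mu\in\mathcal{O}_K$ with $F(0,x_2,x_3,x_4)\equiv\mu(x_2^2+x_3x_4)\pmod{t^2}$. (iv) Suppose that the line $\Gamma=\{x_1=x_2=0\}$ is a component of $\mathcal{C}_k$ of multiplicity $m\ge 2$, and that $\tilde F=q(x_1,x_2)$ and $\tilde G=x_1x_3+\mu x_2x_4+q'(x_1,x_2)$, where $\mu\in\{0,1\}$ and $q,q'$ are quadratic forms over $k$. If $\nu(F(0,0,x_3,x_4))=1$, then $\mathcal{C}$ is normal at $\Gamma$. -/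

import Mathlib

open AlgebraicGeometry CategoryTheory CategoryTheory.Limits MvPolynomial

universe u

noncomputable section

/-! ### The quotient of a graded ring by a homogeneous ideal -/

namespace HomogQuot

variable {R A : Type u} [CommRing R] [CommRing A] [Algebra R A]
  (𝒜 : ℕ → Submodule R A) [GradedAlgebra 𝒜] (I : HomogeneousIdeal 𝒜)

/-- The degree `n` part of `A ⧸ I`: the image of the degree `n` part of `A`. -/
def grading (n : ℕ) : Submodule R (A ⧸ I.toIdeal) :=
  (𝒜 n).map (Ideal.Quotient.mkₐ R I.toIdeal).toLinearMap

instance gradedMonoid : SetLike.GradedMonoid (grading 𝒜 I) where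
  one_mem := ⟨1, SetLike.GradedOne.one_mem, map_one (Ideal.Quotient.mk I.toIdeal)⟩
  mul_mem := by
    rintro i j _ _ ⟨a, ha, rfl⟩ ⟨b, hb, rfl⟩
    exact ⟨a * b, SetLike.GradedMul.mul_mem ha hb, map_mul (Ideal.Quotient.mk I.toIdeal) a b⟩

/-- The projection `𝒜 n → (A ⧸ I)ₙ`. -/
def gradeMap (n : ℕ) : 𝒜 n →+ grading 𝒜 I n where
  toFun a := ⟨Ideal.Quotient.mk I.toIdeal a, a, a.2, rfl⟩
  map_zero' := Subtype.ext (map_zero _)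
  map_add' _ _ := Subtype.ext (map_add _ _ _)

/-- Decompose in `A`, then project each component to `A ⧸ I`. -/
def preDecompose : A →+ DirectSum ℕ (fun n => grading 𝒜 I n) :=
  (DirectSum.map (gradeMap 𝒜 I)).comp (DirectSum.decomposeAddEquiv 𝒜).toAddMonoidHom

theorem preDecompose_apply (a : A) (n : ℕ) :
    ((preDecompose 𝒜 I a n : grading 𝒜 I n) : A ⧸ I.toIdeal) =
      Ideal.Quotient.mk I.toIdeal (DirectSum.decompose 𝒜 a n : A) := by
  simp [preDecompose, gradeMap]

theorem preDecompose_of_mem (a : A) (ha : a ∈ I.toIdeal) : preDecompose 𝒜 I a = 0 := by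
  refine DFinsupp.ext fun n => Subtype.ext ?_
  rw [preDecompose_apply]
  exact Ideal.Quotient.eq_zero_iff_mem.mpr (I.isHomogeneous n ha)

/-- The decomposition of `A ⧸ I` into homogeneous components. -/
def decomp : (A ⧸ I.toIdeal) →+ DirectSum ℕ (fun n => grading 𝒜 I n) :=
  QuotientAddGroup.lift I.toIdeal.toAddSubgroup (preDecompose 𝒜 I) fun a ha =>
    preDecompose_of_mem 𝒜 I a ha

theorem decomp_mk (a : A) : decomp 𝒜 I (Ideal.Quotient.mk I.toIdeal a) = preDecompose 𝒜 I a :=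
  rfl

theorem preDecompose_of_mem_grade {n : ℕ} (a : A) (ha : a ∈ 𝒜 n) :
    preDecompose 𝒜 I a = DirectSum.of (fun n => grading 𝒜 I n) n (gradeMap 𝒜 I n ⟨a, ha⟩) := by
  lift a to 𝒜 n using ha
  simp [preDecompose]

instance gradedRing : GradedRing (grading 𝒜 I) where
  decompose' := decomp 𝒜 I
  left_inv x := by
    obtain ⟨a, rfl⟩ := Ideal.Quotient.mk_surjective x
    induction a using DirectSum.Decomposition.inductionOn 𝒜 with
    | zero => simp
    | homogeneous a =>
      rw [decomp_mk, preDecompose_of_mem_grade 𝒜 I a.1 a.2, DirectSum.coeAddMonoidHom_of]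
      rfl
    | add a b ha hb => rw [map_add, map_add, map_add, ha, hb]
  right_inv x := by
    induction x using DirectSum.induction_on with
    | zero => simp
    | of n x =>
      obtain ⟨_, a, ha, rfl⟩ := x
      rw [DirectSum.coeAddMonoidHom_of]
      exact preDecompose_of_mem_grade 𝒜 I a ha
    | add x y hx hy => rw [map_add, map_add, hx, hy]

end HomogQuot

/-! ### Normality and multiplicity for schemes -/

/-- `X` is normal at `x`: the local ring at `x` is an integrally closed domain. -/
def SchemeNormalAt (X : Scheme.{u}) (x : X) : Prop :=
  IsDomain (X.presheaf.stalk x) ∧ IsIntegrallyClosed (X.presheaf.stalk x)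

/-- `X` is normal: it is normal at all of its points. -/
def SchemeNormal (X : Scheme.{u}) : Prop :=
  ∀ x : X, SchemeNormalAt X x

/-- The length of the local ring of `Y` at `y`. If `y` is the generic point of an irreducible
component of `Y`, this is the multiplicity of that component in `Y`. -/
def lengthAt (Y : Scheme.{u}) (y : Y) : ℕ∞ :=
  Module.length (Y.presheaf.stalk y) (Y.presheaf.stalk y)

/-! ### Pairs of quaternary quadratic forms and the schemes they define -/

/-- A genus one equation `F = G = 0` of degree `4` with coefficients in `R`: a pair of quadratic
forms in the four variables `x₁, …, x₄`, which are `X 0, …, X 3` here. -/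
structure QuadricPair (R : Type u) [CommRing R] where
  F : MvPolynomial (Fin 4) R
  G : MvPolynomial (Fin 4) R
  hF : F.IsHomogeneous 2
  hG : G.IsHomogeneous 2

namespace QuadricPair

attribute [local instance] MvPolynomial.gradedAlgebra

section Scheme

variable {R : Type u} [CommRing R] (φ : QuadricPair R)

/-- The homogeneous ideal `(F, G)` of `R[x₁, …, x₄]`. -/
def ideal : HomogeneousIdeal (homogeneousSubmodule (Fin 4) R) where
  toSubmodule := Ideal.span {φ.F, φ.G}
  is_homogeneous' := Ideal.homogeneous_span _ _ (by
    rintro x (rfl | rfl)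
    · exact ⟨2, φ.hF⟩
    · exact ⟨2, φ.hG⟩)

/-- The homogeneous coordinate ring `R[x₁, …, x₄] ⧸ (F, G)`. -/
abbrev CoordRing : Type u := MvPolynomial (Fin 4) R ⧸ φ.ideal.toIdeal

/-- The grading of the homogeneous coordinate ring by degree. -/
abbrev grading : ℕ → Submodule R φ.CoordRing :=
  HomogQuot.grading (homogeneousSubmodule (Fin 4) R) φ.ideal

/-- The closed subscheme `F = G = 0` of projective `3`-space over `R`,
as `Proj (R[x₁, …, x₄] ⧸ (F, G))`. -/
def scheme : Scheme.{u} := Proj φ.grading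

/-- The structure morphism `{F = G = 0} ⟶ Spec R`. -/
def structureMap : φ.scheme ⟶ Spec (CommRingCat.of R) :=
  Proj.toSpecZero φ.grading ≫ Spec.map (CommRingCat.ofHom (algebraMap R (φ.grading 0)))

/-- The base change of `{F = G = 0}` along `Spec L ⟶ Spec R`. -/
def fiberOver (L : Type u) [CommRing L] [Algebra R L] : Scheme.{u} :=
  pullback φ.structureMap (Spec.map (CommRingCat.ofHom (algebraMap R L)))

/-- The projection from the base change to `{F = G = 0}`. -/
def fiberTo (L : Type u) [CommRing L] [Algebra R L] : φ.fiberOver L ⟶ φ.scheme :=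
  pullback.fst _ _

/-- The structure morphism of the base change. -/
def fiberStructureMap (L : Type u) [CommRing L] [Algebra R L] :
    φ.fiberOver L ⟶ Spec (CommRingCat.of L) :=
  pullback.snd _ _

/-- The closed subset `{x₁ = x₂ = 0}` of `{F = G = 0}`. -/
def lineLocus : Set φ.scheme :=
  {p | ∀ i : Fin 4, i = 0 ∨ i = 1 →
    Ideal.Quotient.mk φ.ideal.toIdeal (X i) ∈
      ProjectiveSpectrum.asHomogeneousIdeal (𝒜 := φ.grading) p}

end Scheme

section LocalRing

variable {R : Type u} [CommRing R] [IsLocalRing R] (φ : QuadricPair R)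

/-- The reduction of `F` to the residue field. -/
def redF : MvPolynomial (Fin 4) (IsLocalRing.ResidueField R) :=
  MvPolynomial.map (IsLocalRing.residue R) φ.F

/-- The reduction of `G` to the residue field. -/
def redG : MvPolynomial (Fin 4) (IsLocalRing.ResidueField R) :=
  MvPolynomial.map (IsLocalRing.residue R) φ.G

/-- The special fibre of `{F = G = 0}`. -/
abbrev specialFiber : Scheme.{u} := φ.fiberOver (IsLocalRing.ResidueField R)

/-- The inclusion of the special fibre. -/
abbrev specialFiberTo : φ.specialFiber ⟶ φ.scheme := φ.fiberTo (IsLocalRing.ResidueField R)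

end LocalRing

end QuadricPair

/-- The valuation of a polynomial: the minimum of the valuations of its coefficients. -/
def polyVal {R : Type u} [CommRing R] [IsDomain R] [IsDiscreteValuationRing R]
    (f : MvPolynomial (Fin 4) R) : ℕ∞ :=
  ⨅ d, IsDiscreteValuationRing.addVal R (f.coeff d)

/-- The polynomial `f(0, x₂, x₃, x₄)`. -/
def restrictPlane {R : Type u} [CommRing R] (f : MvPolynomial (Fin 4) R) :
    MvPolynomial (Fin 4) R :=
  aeval ![0, X 1, X 2, X 3] f

/-- The polynomial `f(0, 0, x₃, x₄)`. -/
def restrictLine {R : Type u} [CommRing R] (f : MvPolynomial (Fin 4) R) :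
    MvPolynomial (Fin 4) R :=
  aeval ![0, 0, X 2, X 3] f

end

/-! Coprimality of the two reductions makes them a regular sequence, so `t` is a nonzerodivisor on
every chart of the scheme (`mem_span_of_C_mul_mem`). Where `t` is invertible the scheme is the
smooth generic fibre, hence normal. What remains is the special fibre, and there normality should be
decided at the generic points of the components, as in Serre's criterion. The role of condition S2
is played by a direct statement: divisibility by `t` can be tested at primes where the ring is
normal (`isNormalDomain_of_localizations`). In (ii) and (iii) this holds because the ideal of the
special fibre is an explicit intersection of primary ideals without embedded components
(`IsPrimaryPiece`, `schemeNormal_of_isPrimaryPiece`).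

At the generic point of a component, normality is obtained from a principal maximal ideal
(`isNormalDomain_of_maximalIdeal_eq_span`). In (i) the generator is `t`, since length one makes the
local ring modulo `t` a field. In (ii), along the double line, and in (iii), the equations turn into
`x ^ 2 = t * H` with maximal ideal `(t, x)`. If `H` is a unit then `x` generates. If not, `x / t` is
integral over the local ring but not in it, because `x` is nonzero modulo `t`
(`normalAtPrime_iff_of_sq_eq`). The conditions on valuations say exactly that `H` does not vanish on
the component. In (iv), `ν = 1` makes `t` an element of `p ^ 2` locally, the equation `G = 0` puts
`x₁` in `(x₂) + p ^ 2`, and Nakayama leaves `x₂` as the only generator. -/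

/-! ### Normality of étale and smooth algebras. -/

/-- A domain that is integrally closed in its fraction field. -/
def IsNormalDomain (A : Type*) [CommRing A] : Prop :=
  IsDomain A ∧ IsIntegrallyClosed A

theorem IsNormalDomain.of_ringEquiv {A B : Type*} [CommRing A] [CommRing B] (e : A ≃+* B)
    (h : IsNormalDomain A) : IsNormalDomain B := by
  obtain ⟨_, _⟩ := h
  have := e.symm.injective.isDomain e.symm.toRingHom
  exact ⟨this, IsIntegrallyClosed.of_equiv e⟩

/-- An idempotent of `E` is a root of `X * (X - 1)`, so it is integral and lies in the local ring
`A`, where only 0 and 1 are idempotent. A reduced Artinian ring with no other idempotents is a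
field, and `hsurj` makes it the fraction field of `A`. -/
theorem isNormalDomain_of_isIntegrallyClosedIn {A E : Type*} [CommRing A] [CommRing E]
    [Algebra A E] [IsLocalRing A] [IsArtinianRing E] [IsReduced E] [IsIntegrallyClosedIn A E]
    (hsurj : ∀ e : E, ∃ a b : A, IsUnit (algebraMap A E b) ∧
      e * algebraMap A E b = algebraMap A E a) : IsNormalDomain A := by
  obtain ⟨hinj, hcl⟩ := isIntegrallyClosedIn_iff.mp ‹IsIntegrallyClosedIn A E›
  have hnt : Nontrivial E := hinj.nontrivial
  have hidem : ∀ e : E, e * e = e → e = 0 ∨ e = 1 := by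
    intro e he
    obtain ⟨a, rfl⟩ := hcl (x := e) ⟨Polynomial.X * (Polynomial.X - 1),
      Polynomial.monic_X.mul (Polynomial.monic_X_sub_C 1), by
        rw [Polynomial.eval₂_mul, Polynomial.eval₂_sub, Polynomial.eval₂_X, Polynomial.eval₂_one,
          mul_sub, he, mul_one, sub_self]⟩
    have ha : a * (1 - a) = 0 := hinj (by simp [mul_sub, he])
    rcases IsLocalRing.isUnit_or_isUnit_one_sub_self a with h | h
    · right
      rw [h.mul_right_eq_zero, sub_eq_zero] at ha
      rw [← ha, map_one]
    · left
      rw [h.mul_left_eq_zero] at ha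
      rw [ha, map_zero]
  have hfield : IsField E := by
    refine ⟨⟨0, 1, zero_ne_one⟩, mul_comm, ?_⟩
    intro x hx
    -- The powers of `x` stabilise: `x ^ (n + 1) * y = x ^ n`. Hence `x * (1 - x * y)` is nilpotent,
    -- so zero, and `x * y` is idempotent.
    obtain ⟨n, y, hy⟩ := IsArtinian.exists_pow_succ_smul_dvd x (1 : E)
    simp only [smul_eq_mul, mul_one] at hy
    have hn : IsNilpotent (x * (1 - x * y)) := by
      refine ⟨n + 1, ?_⟩
      have : x ^ n * (1 - x * y) = 0 := by
        rw [pow_succ] at hy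
        linear_combination (-1 : E) * hy
      calc (x * (1 - x * y)) ^ (n + 1) = x * (1 - x * y) ^ n * (x ^ n * (1 - x * y)) := by
            rw [mul_pow]; ring
        _ = 0 := by rw [this, mul_zero]
    have h0 := hn.eq_zero
    have hx2 : x = x * (x * y) := by linear_combination h0
    rcases hidem (x * y) (by linear_combination (-y) * h0) with h | h
    · rw [h, mul_zero] at hx2; exact absurd hx2 hx
    · exact ⟨y, h⟩
  let := hfield.toField
  have hdom : IsDomain A := hinj.isDomain (algebraMap A E)
  have : FaithfulSMul A E := (faithfulSMul_iff_algebraMap_injective A E).mpr hinj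
  have hfrac : IsFractionRing A E := by
    refine (IsFractionRing.of_field A E ?_)
    intro e
    obtain ⟨a, b, hb, h⟩ := hsurj e
    exact ⟨a, b, by rw [div_eq_mul_inv, ← h, mul_assoc, mul_inv_cancel₀ hb.ne_zero, mul_one]⟩
  exact ⟨hdom, (isIntegrallyClosed_iff_isIntegrallyClosedIn E).mpr ‹_›⟩

-- Integral closure commutes with smooth base change and with localisation, so the local ring `A` of
-- `C` is integrally closed in `A ⊗[P] L`, where `L` is the fraction field of `P`. That ring is
-- étale and finite over `L`, hence reduced and Artinian, and the previous criterion applies.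
open TensorProduct in
theorem isNormalDomain_localization_of_etale {P C : Type*} [CommRing P] [IsDomain P]
    [IsIntegrallyClosed P] [CommRing C] [Algebra P C] [Algebra.Etale P C] (q : Ideal C)
    [q.IsPrime] : IsNormalDomain (Localization.AtPrime q) := by
  let A := Localization.AtPrime q
  let L := FractionRing P
  have h1 : Function.Bijective (TensorProduct.toIntegralClosure P A L) :=
    TensorProduct.toIntegralClosure_bijective_of_tower (S := C)
      TensorProduct.toIntegralClosure_bijective_of_smooth
      (TensorProduct.toIntegralClosure_bijective_of_isLocalization q.primeCompl)
  have : Algebra.FormallyEtale C A := .of_isLocalization q.primeCompl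
  have : Algebra.FormallyEtale P A := .comp P C A
  have : Algebra.EssFiniteType P A := .comp P C A
  let _ : Algebra L (A ⊗[P] L) := Algebra.TensorProduct.rightAlgebra
  have : Algebra.FormallyEtale L (A ⊗[P] L) :=
    .of_equiv (Algebra.TensorProduct.commRight P L A)
  have : Algebra.EssFiniteType L (A ⊗[P] L) :=
    .of_surjective (Algebra.TensorProduct.commRight P L A).toAlgHom
      (Algebra.TensorProduct.commRight P L A).surjective
  have : Module.Finite L (A ⊗[P] L) := Algebra.FormallyUnramified.finite_of_free L _
  have : IsArtinianRing (A ⊗[P] L) := IsArtinianRing.of_finite L _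
  have : _root_.IsReduced (A ⊗[P] L) := Algebra.FormallyUnramified.isReduced_of_field L _
  have hinj : Function.Injective (algebraMap A (A ⊗[P] L)) := by
    have : Module.Flat P A := .trans P C A
    exact Algebra.TensorProduct.includeLeft_injective (S := A) (IsFractionRing.injective P L)
  have hmap : ∀ p : P, algebraMap A (A ⊗[P] L) (algebraMap P A p) = 1 ⊗ₜ algebraMap P L p :=
    fun p => Algebra.TensorProduct.tmul_one_eq_one_tmul p
  have hleft : ∀ a : A, algebraMap A (A ⊗[P] L) a = a ⊗ₜ 1 := fun _ => rfl
  have : IsIntegrallyClosedIn A (A ⊗[P] L) := by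
    refine isIntegrallyClosedIn_iff.mpr ⟨hinj, fun {x} hx => ?_⟩
    obtain ⟨z, hz⟩ := h1.2 ⟨x, hx⟩
    have hz' := congrArg Subtype.val hz
    simp only at hz'
    rw [← hz']
    clear hz hz'
    induction z with
    | zero => exact ⟨0, by simp⟩
    | add a b ha hb =>
      obtain ⟨a', ha'⟩ := ha
      obtain ⟨b', hb'⟩ := hb
      exact ⟨a' + b', by simp [ha', hb']⟩
    | tmul a b =>
      -- `P` is integrally closed, so `b` comes from `P` and can be moved across the tensor product.
      obtain ⟨p, hp⟩ := IsIntegrallyClosed.isIntegral_iff.mp b.2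
      refine ⟨a * algebraMap P A p, ?_⟩
      simp only [TensorProduct.toIntegralClosure, AlgHom.coe_codRestrict,
        Algebra.TensorProduct.map_tmul]
      rw [map_mul, hmap p, hp, hleft, Algebra.TensorProduct.tmul_mul_tmul]
      simp
  refine isNormalDomain_of_isIntegrallyClosedIn (E := A ⊗[P] L) fun e => ?_
  have hu : ∀ p : P, p ≠ 0 → IsUnit (algebraMap A (A ⊗[P] L) (algebraMap P A p)) := by
    intro p hp
    rw [hmap p]
    exact ((IsUnit.mk0 (algebraMap P L p) (by simpa using hp)).map
      (Algebra.TensorProduct.includeRight : L →ₐ[P] A ⊗[P] L) :)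
  induction e with
  | zero => exact ⟨0, 1, by simp, by simp⟩
  | add x y hx hy =>
    obtain ⟨a, b, hb, h⟩ := hx
    obtain ⟨c, d, hd, h'⟩ := hy
    refine ⟨a * d + c * b, b * d, by rw [map_mul]; exact hb.mul hd, ?_⟩
    simp only [map_add, map_mul, ← h, ← h']
    ring
  | tmul a l =>
    obtain ⟨n, d, hd, rfl⟩ := IsFractionRing.div_surjective P l
    have hd0 : d ≠ 0 := nonZeroDivisors.ne_zero hd
    refine ⟨a * algebraMap P A n, algebraMap P A d, hu d hd0, ?_⟩
    have hd1 : algebraMap P L d ≠ 0 := by simpa using hd0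
    rw [map_mul, hmap, hmap, hleft, Algebra.TensorProduct.tmul_mul_tmul,
      Algebra.TensorProduct.tmul_mul_tmul, mul_one, one_mul, div_mul_cancel₀ _ hd1]

/-- Near `q` a smooth algebra is étale over a polynomial ring over `k`, which is integrally closed.
-/
theorem isNormalDomain_localization_of_smooth {k B : Type*} [Field k] [CommRing B] [Algebra k B]
    [Algebra.Smooth k B] (q : Ideal B) [q.IsPrime] :
    IsNormalDomain (Localization.AtPrime q) := by
  obtain ⟨f, hf, n, _, _, _⟩ := Algebra.IsSmoothAt.exists_isStandardEtale_mvPolynomial (R := k)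
    (p := q)
  have hp : (Ideal.map (algebraMap B (Localization.Away f)) q).IsPrime :=
    IsLocalization.isPrime_of_isPrime_disjoint (.powers f) _ _ ‹_›
      ((Ideal.disjoint_powers_iff_notMem_of_isPrime _).mpr hf)
  have hcomap : (Ideal.map (algebraMap B (Localization.Away f)) q).comap
      (algebraMap B (Localization.Away f)) = q :=
    IsLocalization.under_map_of_isPrime_disjoint (.powers f) _ ‹_›
      ((Ideal.disjoint_powers_iff_notMem_of_isPrime _).mpr hf)
  have h := isNormalDomain_localization_of_etale (P := MvPolynomial (Fin n) k)
    (Ideal.map (algebraMap B (Localization.Away f)) q)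
  have := IsLocalization.isLocalization_isLocalization_atPrime_isLocalization
    (Submonoid.powers f) (Localization.AtPrime (Ideal.map (algebraMap B (Localization.Away f)) q))
    (Ideal.map (algebraMap B (Localization.Away f)) q)
  have : IsLocalization.AtPrime
      (Localization.AtPrime (Ideal.map (algebraMap B (Localization.Away f)) q)) q := by
    convert this
    exact hcomap.symm
  exact h.of_ringEquiv (IsLocalization.algEquiv q.primeCompl _ _).toRingEquiv

/-! ### Tests for normality of a Noetherian local ring. -/

-- By Krull's intersection theorem every nonzero element is a unit times a power of `π`. The
-- nonzerodivisor `t` is a multiple of `π`, so `π` is not nilpotent and such products never vanish.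
open IsLocalRing in
theorem isNormalDomain_of_maximalIdeal_eq_span {A : Type*} [CommRing A] [IsLocalRing A]
    [IsNoetherianRing A] {t π : A} (ht : t ∈ nonZeroDivisors A) (htm : t ∈ maximalIdeal A)
    (hπ : maximalIdeal A = Ideal.span {π}) : IsNormalDomain A := by
  have hpow : ∀ n, π ^ n ≠ 0 := by
    intro n hn
    rw [hπ, Ideal.mem_span_singleton] at htm
    have : t ^ n = 0 := by
      obtain ⟨c, rfl⟩ := htm
      rw [mul_pow, hn, zero_mul]
    exact nonZeroDivisors.ne_zero (pow_mem ht n) this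
  have hrep : ∀ a : A, a ≠ 0 → ∃ n u, IsUnit u ∧ a = π ^ n * u := by
    intro a ha
    have hex : ∃ n, a ∉ maximalIdeal A ^ n := by
      by_contra! h
      apply ha
      have : a ∈ ⨅ n, maximalIdeal A ^ n := by simpa using h
      rwa [Ideal.iInf_pow_eq_bot_of_isLocalRing _ (Ideal.IsPrime.ne_top inferInstance)] at this
    classical
    have hpos : Nat.find hex ≠ 0 := fun h0 => by
      have := Nat.find_spec hex
      rw [h0] at this
      simp at this
    obtain ⟨n, hn⟩ := Nat.exists_eq_succ_of_ne_zero hpos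
    have h1 : a ∈ maximalIdeal A ^ n := by
      by_contra h
      have := Nat.find_min' hex h
      omega
    have h2 : a ∉ maximalIdeal A ^ (n + 1) := by
      have := Nat.find_spec hex
      rwa [hn] at this
    rw [hπ, Ideal.span_singleton_pow, Ideal.mem_span_singleton] at h1 h2
    obtain ⟨u, rfl⟩ := h1
    refine ⟨n, u, ?_, rfl⟩
    by_contra hu
    apply h2
    have : u ∈ maximalIdeal A := hu
    rw [hπ, Ideal.mem_span_singleton] at this
    rw [pow_succ]
    exact mul_dvd_mul_left _ this
  have : NoZeroDivisors A := by
    refine ⟨fun {a b} hab => ?_⟩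
    by_contra! h
    obtain ⟨n, u, hu, rfl⟩ := hrep a h.1
    obtain ⟨m, v, hv, rfl⟩ := hrep b h.2
    have : π ^ (n + m) * (u * v) = 0 := by rw [← hab]; ring
    rw [(hu.mul hv).mul_left_eq_zero] at this
    exact hpow _ this
  have hdom : IsDomain A := NoZeroDivisors.to_isDomain A
  have hprin : (maximalIdeal A).IsPrincipal := ⟨⟨π, hπ⟩⟩
  have : IsPrincipalIdealRing A :=
    ((tfae_of_isNoetherianRing_of_isLocalRing_of_isDomain A).out 4 0).mp hprin
  exact ⟨hdom, inferInstance⟩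

open IsLocalRing in
theorem maximalIdeal_eq_span_of_le_sup {A : Type*} [CommRing A] [IsLocalRing A]
    [IsNoetherianRing A] {π : A} (hπ : π ∈ maximalIdeal A)
    (h : maximalIdeal A ≤ Ideal.span {π} ⊔ maximalIdeal A ^ 2) :
    maximalIdeal A = Ideal.span {π} := by
  refine le_antisymm ?_ ((Ideal.span_singleton_le_iff_mem _).mpr hπ)
  refine Submodule.le_of_le_smul_of_le_jacobson_bot (I := maximalIdeal A)
    (IsNoetherian.noetherian _) (IsLocalRing.maximalIdeal_le_jacobson _) ?_
  rwa [smul_eq_mul, ← pow_two]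

/-- The fraction `x / t` is a root of the monic polynomial `X ^ 2 - b X - a`. -/
theorem dvd_of_sq_eq_mul {A : Type*} [CommRing A] (hA : IsNormalDomain A) {x t a b : A}
    (ht : t ≠ 0) (h : x ^ 2 = t * (t * a + x * b)) : t ∣ x := by
  obtain ⟨_, _⟩ := hA
  have ht' : algebraMap A (FractionRing A) t ≠ 0 := by simpa using ht
  have hint : IsIntegral A (algebraMap A (FractionRing A) x / algebraMap A (FractionRing A) t) := by
    refine ⟨Polynomial.X ^ 2 - Polynomial.C b * Polynomial.X - Polynomial.C a, ?_, ?_⟩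
    · rw [sub_sub]
      refine Polynomial.monic_X_pow_sub ?_
      compute_degree
      norm_num
    · have h' := congrArg (algebraMap A (FractionRing A)) h
      simp only [map_pow, map_mul, map_add] at h'
      simp only [Polynomial.eval₂_sub, Polynomial.eval₂_mul, Polynomial.eval₂_pow,
        Polynomial.eval₂_X, Polynomial.eval₂_C]
      field_simp
      linear_combination h'
  obtain ⟨y, hy⟩ := IsIntegrallyClosed.isIntegral_iff.mp hint
  refine ⟨y, IsFractionRing.injective A (FractionRing A) ?_⟩
  rw [map_mul, hy, mul_div_cancel₀ _ ht']

/-! ### Normality from localisations: a substitute for Serre's criterion. -/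

/-- A prime `P` of `A` at which the local ring is a normal domain. -/
def NormalAtPrime {A : Type*} [CommRing A] (P : Ideal A) : Prop :=
  ∃ _ : P.IsPrime, IsNormalDomain (Localization.AtPrime P)

theorem exists_notMem_mul_eq_zero_of_fg {A : Type*} [CommRing A] {P I : Ideal A} [P.IsPrime]
    (hI : I.FG) (h : ∀ z ∈ I, ∃ s ∉ P, s * z = 0) : ∃ s ∉ P, ∀ z ∈ I, s * z = 0 := by
  classical
  obtain ⟨S, rfl⟩ := hI
  choose! s hs hs' using fun z (hz : z ∈ S) => h z (Ideal.subset_span hz)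
  refine ⟨∏ z ∈ S, s z, fun hmem => ?_, fun z hz => ?_⟩
  · obtain ⟨z, hz, hz'⟩ := (Ideal.IsPrime.prod_mem_iff).mp hmem
    exact hs z hz hz'
  · induction hz using Submodule.span_induction with
    | mem x hx =>
      rw [← Finset.prod_erase_mul _ _ hx, mul_assoc, hs' x hx, mul_zero]
    | zero => simp
    | add x y _ _ hx hy => rw [mul_add, hx, hy, add_zero]
    | smul a x _ hx => rw [smul_eq_mul, mul_left_comm, hx, mul_zero]

/-- The hypothesis `h2` is the form in which S2 is used: divisibility by `t` is detected at normal
primes. It passes to powers because `t` can be cancelled. -/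
theorem pow_dvd_of_forall {A : Type*} [CommRing A] {t : A} (ht : t ∈ nonZeroDivisors A)
    (h2 : ∀ c : A, (∀ P, NormalAtPrime P → ∃ s ∉ P, t ∣ s * c) → t ∣ c) (n : ℕ) (c : A)
    (hc : ∀ P, NormalAtPrime P → ∃ s ∉ P, t ^ n ∣ s * c) : t ^ n ∣ c := by
  induction n generalizing c with
  | zero => simp
  | succ n ih =>
    obtain ⟨d, rfl⟩ := ih c fun P hP => by
      obtain ⟨s, hs, h⟩ := hc P hP
      exact ⟨s, hs, (pow_dvd_pow t n.le_succ).trans h⟩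
    rw [pow_succ]
    refine mul_dvd_mul_left _ (h2 d fun P hP => ?_)
    obtain ⟨s, hs, w, h⟩ := hc P hP
    refine ⟨s, hs, w, ?_⟩
    refine (mul_cancel_left_mem_nonZeroDivisors (pow_mem ht n)).mp ?_
    rw [← mul_left_comm, h]
    ring

theorem NormalAtPrime.exists_of_mul_eq_zero {A : Type*} [CommRing A] {P : Ideal A}
    (hP : NormalAtPrime P) {a b : A} (h : a * b = 0) :
    (∃ s ∉ P, s * a = 0) ∨ ∃ s ∉ P, s * b = 0 := by
  obtain ⟨_, _, _⟩ := hP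
  have h' : algebraMap A (Localization.AtPrime P) a * algebraMap A (Localization.AtPrime P) b = 0 := by
    rw [← map_mul, h, map_zero]
  rcases mul_eq_zero.mp h' with h | h
  · left
    obtain ⟨⟨s, hs⟩, h⟩ := (IsLocalization.map_eq_zero_iff P.primeCompl _ _).mp h
    exact ⟨s, hs, h⟩
  · right
    obtain ⟨⟨s, hs⟩, h⟩ := (IsLocalization.map_eq_zero_iff P.primeCompl _ _).mp h
    exact ⟨s, hs, h⟩

theorem exists_pow_mem_of_forall_isPrime {A : Type*} [CommRing A] {J : Ideal A} {t : A}
    (h : ∀ P : Ideal A, P.IsPrime → t ∉ P → ∃ s ∉ P, s ∈ J) : ∃ n, t ^ n ∈ J := by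
  change t ∈ J.radical
  rw [Ideal.radical_eq_sInf, Submodule.mem_sInf]
  rintro P ⟨hJ, hP⟩
  by_contra ht
  obtain ⟨s, hs, hs'⟩ := h P hP ht
  exact hs (hJ hs')

/-- If `a * b = 0`, let `I` be the annihilator of `a` and `I'` that of `I`. Off `V(t)` the local
rings are domains, so `I` and `I'` together contain a power `t ^ n = u + v` with `u * v = 0`. This
splitting of `D(t)` extends over `V(t)` by `h2`, as an idempotent `e` with `u = t ^ n * e`. A local
ring has only trivial idempotents, so `t ^ n` kills `a` or `b`. -/
theorem isDomain_of_localizations {A : Type*} [CommRing A] [IsLocalRing A] [IsNoetherianRing A]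
    {t : A} (ht : t ∈ nonZeroDivisors A)
    (h1 : ∀ P : Ideal A, P.IsPrime → t ∉ P → NormalAtPrime P)
    (h2 : ∀ c : A, (∀ P, NormalAtPrime P → ∃ s ∉ P, t ∣ s * c) → t ∣ c) : IsDomain A := by
  have : NoZeroDivisors A := by
    refine ⟨fun {a b} hab => ?_⟩
    by_contra! hne
    let I : Ideal A := LinearMap.ker (LinearMap.mulLeft A a)
    have hI : ∀ z, z ∈ I ↔ a * z = 0 := fun z => by simp [I]
    let I' : Ideal A := I.annihilator
    obtain ⟨n, hn⟩ : ∃ n, t ^ n ∈ I ⊔ I' := by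
      refine exists_pow_mem_of_forall_isPrime fun P hP htP => ?_
      have hNP := h1 P hP htP
      by_cases ha : ∃ s ∉ P, s * a = 0
      · obtain ⟨s, hs, h⟩ := ha
        exact ⟨s, hs, Ideal.mem_sup_left ((hI s).mpr (by rw [mul_comm, h]))⟩
      · obtain ⟨s, hs, h⟩ := exists_notMem_mul_eq_zero_of_fg (P := P)
          (IsNoetherian.noetherian I) fun z hz =>
            (hNP.exists_of_mul_eq_zero ((hI z).mp hz)).resolve_left ha
        exact ⟨s, hs, Ideal.mem_sup_right (Submodule.mem_annihilator.mpr h)⟩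
    obtain ⟨u, hu, v, hv, huv⟩ := Submodule.mem_sup.mp hn
    have hvu : v * u = 0 := Submodule.mem_annihilator.mp hv u hu
    have hvb : v * b = 0 := Submodule.mem_annihilator.mp hv b ((hI b).mpr hab)
    have hua : a * u = 0 := (hI u).mp hu
    obtain ⟨e, rfl⟩ : t ^ n ∣ u := by
      -- At a normal prime one of `u`, `v` vanishes, so `u` is locally `t ^ n` or 0.
      refine pow_dvd_of_forall ht h2 n u fun P hP => ?_
      rcases hP.exists_of_mul_eq_zero hvu with ⟨s, hs, h⟩ | ⟨s, hs, h⟩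
      · exact ⟨s, hs, s, by linear_combination s * huv - h⟩
      · exact ⟨s, hs, 0, by rw [h, mul_zero]⟩
    have htn := pow_mem ht n
    have he : e * (1 - e) = 0 := by
      have : t ^ n * (t ^ n * (e * (1 - e))) = t ^ n * (t ^ n * 0) := by
        linear_combination hvu - (t ^ n * e) * huv
      exact (mul_cancel_left_mem_nonZeroDivisors htn).mp
        ((mul_cancel_left_mem_nonZeroDivisors htn).mp this)
    rcases IsLocalRing.isUnit_or_isUnit_one_sub_self e with h | h
    · rw [h.mul_right_eq_zero, sub_eq_zero] at he
      rw [← he, mul_one] at hua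
      exact hne.1 ((mul_right_mem_nonZeroDivisors_eq_zero_iff htn).mp hua)
    · rw [h.mul_left_eq_zero] at he
      rw [he, mul_zero, zero_add] at huv
      rw [huv] at hvb
      exact hne.2 ((mul_left_mem_nonZeroDivisors_eq_zero_iff htn).mp hvb)
  exact NoZeroDivisors.to_isDomain A

theorem exists_mul_eq_algebraMap_of_isIntegral {A : Type*} [CommRing A] [IsDomain A] {P : Ideal A}
    [P.IsPrime] (T : Type*) [CommRing T] [Algebra A T] [IsLocalization.AtPrime T P] [IsDomain T]
    [IsIntegrallyClosed T] {y : FractionRing A} (hy : IsIntegral A y) :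
    ∃ d ∉ P, ∃ w, algebraMap A (FractionRing A) d * y = algebraMap A (FractionRing A) w := by
  have hinj : Function.Injective (algebraMap A (FractionRing T)) := by
    rw [IsScalarTower.algebraMap_eq A T (FractionRing T)]
    exact (IsFractionRing.injective T (FractionRing T)).comp
      (IsLocalization.injective T P.primeCompl_le_nonZeroDivisors)
  let j : FractionRing A →ₐ[A] FractionRing T :=
    IsFractionRing.liftAlgHom (g := Algebra.ofId A (FractionRing T)) hinj
  have hj : IsIntegral T (j y) := (hy.map j).tower_top
  obtain ⟨w, hw⟩ := IsIntegrallyClosed.isIntegral_iff.mp hj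
  obtain ⟨⟨n, ⟨s, hs⟩⟩, hns⟩ := IsLocalization.surj P.primeCompl w
  refine ⟨s, hs, n, (j : FractionRing A →+* FractionRing T).injective ?_⟩
  have h' := congrArg (algebraMap T (FractionRing T)) hns
  rw [map_mul, ← IsScalarTower.algebraMap_apply, ← IsScalarTower.algebraMap_apply, hw] at h'
  simp only [RingHom.coe_coe, map_mul, AlgHom.commutes]
  rw [mul_comm]
  exact h'

theorem NormalAtPrime.exists_mul_eq_algebraMap {A : Type*} [CommRing A] [IsDomain A] {P : Ideal A}
    (hP : NormalAtPrime P) {y : FractionRing A} (hy : IsIntegral A y) :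
    ∃ d ∉ P, ∃ w, algebraMap A (FractionRing A) d * y = algebraMap A (FractionRing A) w := by
  obtain ⟨_, _, _⟩ := hP
  exact exists_mul_eq_algebraMap_of_isIntegral (Localization.AtPrime P) hy

/-- The denominators of an integral fraction `y` form an ideal `D` that is trivial at each prime
avoiding `t`, so `t ^ n * y = c` lies in `A`. At normal primes `y` is already in the local ring,
hence `t ^ n` divides `c` there, and by `h2` everywhere. -/
theorem isNormalDomain_of_localizations {A : Type*} [CommRing A] [IsLocalRing A]
    [IsNoetherianRing A] {t : A} (ht : t ∈ nonZeroDivisors A)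
    (h1 : ∀ P : Ideal A, P.IsPrime → t ∉ P → NormalAtPrime P)
    (h2 : ∀ c : A, (∀ P, NormalAtPrime P → ∃ s ∉ P, t ∣ s * c) → t ∣ c) : IsNormalDomain A := by
  have hdom := isDomain_of_localizations ht h1 h2
  refine ⟨hdom, (isIntegrallyClosed_iff (FractionRing A)).mpr fun {y} hy => ?_⟩
  let D : Ideal A := ((1 : Submodule A (FractionRing A)).comap (LinearMap.toSpanSingleton A _ y))
  have hD : ∀ d, d ∈ D ↔ ∃ w, algebraMap A (FractionRing A) d * y =
      algebraMap A (FractionRing A) w := by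
    intro d
    simp only [D, Submodule.mem_comap, LinearMap.toSpanSingleton_apply, Submodule.mem_one,
      Algebra.smul_def, eq_comm]
  obtain ⟨n, hn⟩ : ∃ n, t ^ n ∈ D := by
    refine exists_pow_mem_of_forall_isPrime fun P hP htP => ?_
    obtain ⟨d, hd, hd'⟩ := (h1 P hP htP).exists_mul_eq_algebraMap hy
    exact ⟨d, hd, (hD d).mpr hd'⟩
  obtain ⟨c, hc⟩ := (hD _).mp hn
  have hinj := IsFractionRing.injective A (FractionRing A)
  obtain ⟨e, rfl⟩ : t ^ n ∣ c := by
    refine pow_dvd_of_forall ht h2 n c fun P hP => ?_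
    obtain ⟨d, hd, w, hw⟩ := hP.exists_mul_eq_algebraMap hy
    refine ⟨d, hd, w, hinj ?_⟩
    rw [map_mul, map_mul, ← hc, ← hw]
    ring
  refine ⟨e, ?_⟩
  rw [map_mul] at hc
  refine (mul_left_cancel₀ ?_ hc).symm
  simpa using nonZeroDivisors.ne_zero (pow_mem ht n)

theorem normalAtPrime_comap_iff {B : Type*} [CommRing B] (q : Ideal B) [q.IsPrime]
    (P : Ideal (Localization.AtPrime q)) [P.IsPrime] :
    NormalAtPrime (P.comap (algebraMap B (Localization.AtPrime q))) ↔ NormalAtPrime P := by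
  have e := (IsLocalization.localizationLocalizationAtPrimeIsoLocalization q.primeCompl P).toRingEquiv
  exact ⟨fun h => ⟨inferInstance, h.2.of_ringEquiv e⟩,
    fun h => ⟨inferInstance, h.2.of_ringEquiv e.symm⟩⟩

/-- The preceding criterion for the local ring at `q`, with all denominators cleared: its primes are
the primes of `B` inside `q`, and divisibility holds up to a factor outside `q` or `p`. -/
theorem normalAtPrime_of_forall_le {B : Type*} [CommRing B] [IsNoetherianRing B] {t : B}
    (ht : t ∈ nonZeroDivisors B) (q : Ideal B) [q.IsPrime]
    (h1 : ∀ p : Ideal B, p.IsPrime → p ≤ q → t ∉ p → NormalAtPrime p)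
    (h2 : ∀ b : B, (∀ p ≤ q, NormalAtPrime p → ∃ s ∉ p, t ∣ s * b) → ∃ u ∉ q, t ∣ u * b) :
    NormalAtPrime q := by
  let A := Localization.AtPrime q
  have hle : ∀ P : Ideal A, P.IsPrime → P.comap (algebraMap B A) ≤ q := by
    intro P hP x hx
    by_contra hxq
    exact hP.ne_top (P.eq_top_of_isUnit_mem hx (IsLocalization.map_units A (⟨x, hxq⟩ : q.primeCompl)))
  refine ⟨‹_›, isNormalDomain_of_localizations (t := algebraMap B A t) ?_ ?_ ?_⟩
  · exact IsLocalization.map_nonZeroDivisors_le q.primeCompl A (Submonoid.mem_map_of_mem _ ht)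
  · intro P hP htP
    exact (normalAtPrime_comap_iff q P).mp (h1 _ inferInstance (hle P hP) htP)
  · intro c hc
    obtain ⟨⟨b, ⟨v, hv⟩⟩, hbv⟩ := IsLocalization.surj q.primeCompl c
    have hvu : IsUnit (algebraMap B A v) := IsLocalization.map_units A (⟨v, hv⟩ : q.primeCompl)
    obtain ⟨u, hu, w, huw⟩ := h2 b fun p hpq hp => by
      obtain ⟨_, _⟩ := id hp
      have hdisj : Disjoint (q.primeCompl : Set B) p :=
        Set.disjoint_left.mpr fun x hx hx' => hx (hpq hx')
      have hP : (p.map (algebraMap B A)).IsPrime :=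
        IsLocalization.isPrime_of_isPrime_disjoint q.primeCompl _ _ ‹_› hdisj
      have hcomap : (p.map (algebraMap B A)).comap (algebraMap B A) = p :=
        IsLocalization.under_map_of_isPrime_disjoint q.primeCompl _ ‹_› hdisj
      obtain ⟨s, hs, w, hw⟩ := hc _ ((normalAtPrime_comap_iff q _).mp (by rwa [hcomap]))
      obtain ⟨⟨s', ⟨v', hv'⟩⟩, hsv⟩ := IsLocalization.surj q.primeCompl s
      obtain ⟨⟨w', ⟨v'', hv''⟩⟩, hwv⟩ := IsLocalization.surj q.primeCompl w
      replace hsv : s * algebraMap B A v' = algebraMap B A s' := hsv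
      replace hwv : w * algebraMap B A v'' = algebraMap B A w' := hwv
      replace hbv : c * algebraMap B A v = algebraMap B A b := hbv
      have hs' : s' ∉ p := by
        intro h
        apply hs
        have := Ideal.mem_map_of_mem (algebraMap B A) h
        rw [← hsv] at this
        exact (hP.mem_or_mem this).resolve_right fun h =>
          hP.ne_top (Ideal.eq_top_of_isUnit_mem _ h
            (IsLocalization.map_units A (⟨v', hv'⟩ : q.primeCompl)))
      have heq : algebraMap B A (v'' * s' * b) = algebraMap B A (t * w' * v' * v) := by
        rw [map_mul, map_mul, map_mul, map_mul, map_mul, ← hsv, ← hwv, ← hbv]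
        linear_combination (algebraMap B A v'' * algebraMap B A v' * algebraMap B A v) * hw
      obtain ⟨⟨r, hr⟩, hr'⟩ := (IsLocalization.eq_iff_exists q.primeCompl A).mp heq
      simp only at hr'
      refine ⟨r * v'' * s', fun h => ?_, r * w' * v' * v, by linear_combination hr'⟩
      rcases ‹p.IsPrime›.mem_or_mem h with h | h
      · exact (q.primeCompl.mul_mem hr hv'') (hpq h)
      · exact hs' h
    have huu : IsUnit (algebraMap B A u) := IsLocalization.map_units A (⟨u, hu⟩ : q.primeCompl)
    have : algebraMap B A t ∣ algebraMap B A u * (c * algebraMap B A v) := by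
      simp only at hbv
      rw [hbv, ← map_mul, huw, map_mul]
      exact dvd_mul_right _ _
    rwa [huu.dvd_mul_left, hvu.dvd_mul_right] at this

/-! ### The affine charts as dehomogenised polynomial rings. -/

namespace QuadricPair

attribute [local instance] MvPolynomial.gradedAlgebra

section Chart

variable {R : Type u} [CommRing R] (φ : QuadricPair R)

/-- The projection `R[x₁, …, x₄] → R[x₁, …, x₄] ⧸ (F, G)`. -/
noncomputable abbrev toCoordRing : MvPolynomial (Fin 4) R →+* φ.CoordRing :=
  Ideal.Quotient.mk φ.ideal.toIdeal

theorem toCoordRing_mem_grading {a : MvPolynomial (Fin 4) R} {n : ℕ} (ha : a.IsHomogeneous n) :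
    φ.toCoordRing a ∈ φ.grading n :=
  ⟨a, (mem_homogeneousSubmodule n a).mpr ha, rfl⟩

theorem exists_of_mem_grading {x : φ.CoordRing} {n : ℕ} (hx : x ∈ φ.grading n) :
    ∃ a : MvPolynomial (Fin 4) R, a.IsHomogeneous n ∧ φ.toCoordRing a = x := by
  obtain ⟨a, ha, rfl⟩ := hx
  exact ⟨a, (mem_homogeneousSubmodule n a).mp ha, rfl⟩

theorem toCoordRing_X_mem (j : Fin 4) : φ.toCoordRing (X j) ∈ φ.grading 1 :=
  φ.toCoordRing_mem_grading (isHomogeneous_X R j)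

/-- The coordinate ring of the affine chart `x_j ≠ 0`. -/
abbrev Chart (j : Fin 4) : Type u :=
  HomogeneousLocalization.Away φ.grading (φ.toCoordRing (X j))

/-- The structure map of the chart `x_j ≠ 0`. -/
noncomputable def chartScalar (j : Fin 4) : R →+* φ.Chart j :=
  (HomogeneousLocalization.fromZeroRingHom φ.grading _).comp (algebraMap R (φ.grading 0))

/-- Dehomogenisation, sending `x_i` to `x_i / x_j`. -/
noncomputable def dehom (j : Fin 4) : MvPolynomial (Fin 4) R →+* φ.Chart j :=
  eval₂Hom (φ.chartScalar j) fun i =>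
    HomogeneousLocalization.Away.mk φ.grading (φ.toCoordRing_X_mem j) 1 (φ.toCoordRing (X i))
      (by simpa using φ.toCoordRing_X_mem i)

@[simp] theorem dehom_C (j : Fin 4) (r : R) : φ.dehom j (C r) = φ.chartScalar j r := by
  simp [dehom]

theorem val_chartScalar (j : Fin 4) (r : R) :
    (φ.chartScalar j r).val =
      algebraMap φ.CoordRing (Localization.Away (φ.toCoordRing (X j))) (φ.toCoordRing (C r)) := by
  rw [← Localization.mk_one_eq_algebraMap]
  rfl

theorem val_dehom_X (j i : Fin 4) :
    (φ.dehom j (X i)).val *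
      algebraMap φ.CoordRing (Localization.Away (φ.toCoordRing (X j))) (φ.toCoordRing (X j)) =
      algebraMap φ.CoordRing (Localization.Away (φ.toCoordRing (X j))) (φ.toCoordRing (X i)) := by
  simp only [dehom, coe_eval₂Hom, eval₂_X, HomogeneousLocalization.Away.val_mk]
  rw [← Localization.mk_one_eq_algebraMap, ← Localization.mk_one_eq_algebraMap, Localization.mk_mul,
    Localization.mk_eq_mk_iff, Localization.r_iff_exists]
  exact ⟨1, by simp [mul_comm]⟩

theorem val_dehom_mul_pow (j : Fin 4) {a : MvPolynomial (Fin 4) R} {n : ℕ}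
    (ha : a.IsHomogeneous n) :
    (φ.dehom j a).val *
      algebraMap φ.CoordRing (Localization.Away (φ.toCoordRing (X j)))
        (φ.toCoordRing (X j)) ^ n =
      algebraMap φ.CoordRing (Localization.Away (φ.toCoordRing (X j))) (φ.toCoordRing a) := by
  have hval : ∀ b, (φ.dehom j b).val =
      algebraMap (φ.Chart j) (Localization.Away (φ.toCoordRing (X j))) (φ.dehom j b) := fun _ => rfl
  rw [hval]
  conv_lhs => rw [← a.support_sum_monomial_coeff]
  conv_rhs => rw [← a.support_sum_monomial_coeff]
  simp only [map_sum, Finset.sum_mul]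
  refine Finset.sum_congr rfl fun d hd => ?_
  have hdn : d.degree = n := by
    have := ha (mem_support_iff.mp hd)
    rw [Finsupp.degree_eq_weight_one]
    exact this
  rw [← hdn, monomial_eq, Finsupp.prod_fintype _ _ (by simp), Finsupp.degree_eq_sum,
    ← Finset.prod_pow_eq_pow_sum]
  simp only [map_mul, map_prod, map_pow]
  rw [mul_assoc, ← Finset.prod_mul_distrib]
  congr 1
  · rw [← hval, dehom_C, val_chartScalar]
  · refine Finset.prod_congr rfl fun i _ => ?_
    rw [← mul_pow, ← hval, val_dehom_X]

theorem dehom_eq_mk (j : Fin 4) {a : MvPolynomial (Fin 4) R} {n : ℕ} (ha : a.IsHomogeneous n) :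
    φ.dehom j a = HomogeneousLocalization.Away.mk φ.grading (φ.toCoordRing_X_mem j) n
      (φ.toCoordRing a) (by simpa using φ.toCoordRing_mem_grading ha) := by
  refine HomogeneousLocalization.val_injective _ ?_
  have hu : IsUnit (algebraMap φ.CoordRing (Localization.Away (φ.toCoordRing (X j)))
        (φ.toCoordRing (X j)) ^ n) :=
    (IsLocalization.map_units (Localization.Away (φ.toCoordRing (X j)))
      (⟨_, 1, pow_one _⟩ : Submonoid.powers (φ.toCoordRing (X j)))).pow n
  rw [← hu.mul_left_inj, val_dehom_mul_pow φ j ha, HomogeneousLocalization.Away.val_mk,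
    ← Localization.mk_one_eq_algebraMap, ← Localization.mk_one_eq_algebraMap, Localization.mk_pow,
    Localization.mk_mul, Localization.mk_eq_mk_iff, Localization.r_iff_exists]
  exact ⟨1, by simp [mul_comm]⟩

/-- This lets every question about a chart be put to homogeneous forms. -/
theorem exists_dehom_eq (j : Fin 4) (b : φ.Chart j) :
    ∃ (n : ℕ) (a : MvPolynomial (Fin 4) R), a.IsHomogeneous n ∧ φ.dehom j a = b := by
  obtain ⟨n, x, hx, rfl⟩ :=
    HomogeneousLocalization.Away.mk_surjective φ.grading (φ.toCoordRing_X_mem j) b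
  obtain ⟨a, ha, rfl⟩ := φ.exists_of_mem_grading hx
  simp only [smul_eq_mul, mul_one] at ha
  exact ⟨n, a, ha, φ.dehom_eq_mk j ha⟩

theorem dehom_surjective (j : Fin 4) : Function.Surjective (φ.dehom j) := fun b => by
  obtain ⟨_, a, _, h⟩ := φ.exists_dehom_eq j b
  exact ⟨a, h⟩

/-- The power of `X j` appears because passing to the chart inverts `X j`. -/
theorem dehom_eq_zero_iff (j : Fin 4) {a : MvPolynomial (Fin 4) R} {n : ℕ}
    (ha : a.IsHomogeneous n) :
    φ.dehom j a = 0 ↔ ∃ m, X j ^ m * a ∈ Ideal.span {φ.F, φ.G} := by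
  have hu : IsUnit (algebraMap φ.CoordRing (Localization.Away (φ.toCoordRing (X j)))
        (φ.toCoordRing (X j)) ^ n) :=
    (IsLocalization.map_units (Localization.Away (φ.toCoordRing (X j)))
      (⟨_, 1, pow_one _⟩ : Submonoid.powers (φ.toCoordRing (X j)))).pow n
  rw [HomogeneousLocalization.ext_iff_val, HomogeneousLocalization.val_zero,
    ← hu.mul_left_eq_zero, val_dehom_mul_pow φ j ha,
    IsLocalization.map_eq_zero_iff (Submonoid.powers (φ.toCoordRing (X j)))]
  constructor
  · rintro ⟨⟨_, m, rfl⟩, h⟩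
    refine ⟨m, ?_⟩
    replace h : φ.toCoordRing (X j) ^ m * φ.toCoordRing a = 0 := h
    rw [← map_pow, ← map_mul] at h
    exact Ideal.Quotient.eq_zero_iff_mem.mp h
  · rintro ⟨m, h⟩
    refine ⟨⟨_, m, rfl⟩, ?_⟩
    change φ.toCoordRing (X j) ^ m * φ.toCoordRing a = 0
    rw [← map_pow, ← map_mul]
    exact Ideal.Quotient.eq_zero_iff_mem.mpr h

@[simp] theorem dehom_X_self (j : Fin 4) : φ.dehom j (X j) = 1 := by
  refine HomogeneousLocalization.val_injective _ ?_
  have hu := IsLocalization.map_units (Localization.Away (φ.toCoordRing (X j)))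
      (⟨_, 1, pow_one _⟩ : Submonoid.powers (φ.toCoordRing (X j)))
  rw [← hu.mul_left_inj, val_dehom_X, HomogeneousLocalization.val_one, one_mul]

theorem dehom_F (j : Fin 4) : φ.dehom j φ.F = 0 :=
  (φ.dehom_eq_zero_iff j φ.hF).mpr ⟨0, by simpa using Ideal.subset_span (by simp)⟩

theorem dehom_G (j : Fin 4) : φ.dehom j φ.G = 0 :=
  (φ.dehom_eq_zero_iff j φ.hG).mpr ⟨0, by simpa using Ideal.subset_span (by simp)⟩

instance [IsNoetherianRing R] (j : Fin 4) : IsNoetherianRing (φ.Chart j) :=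
  isNoetherianRing_of_surjective _ _ (φ.dehom j) (φ.dehom_surjective j)

end Chart

end QuadricPair

/-! ### Points of the scheme and their local rings. -/

theorem schemeNormalAt_iff_of_isOpenImmersion {X Y : Scheme.{u}} (f : X ⟶ Y) [IsOpenImmersion f]
    (x : X) : SchemeNormalAt Y (f x) ↔ SchemeNormalAt X x := by
  have e := (asIso (f.stalkMap x)).commRingCatIsoToRingEquiv
  exact ⟨IsNormalDomain.of_ringEquiv e, IsNormalDomain.of_ringEquiv e.symm⟩

theorem schemeNormalAt_spec_iff (A : CommRingCat.{u}) (p : Spec A) :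
    SchemeNormalAt (Spec A) p ↔ NormalAtPrime p.asIdeal := by
  have : p.asIdeal.IsPrime := p.isPrime
  let _ : Algebra A ((Spec A).presheaf.stalk p) := StructureSheaf.stalkAlgebra A p
  have : IsLocalization.AtPrime ((Spec A).presheaf.stalk p) p.asIdeal :=
    StructureSheaf.IsLocalization.to_stalk A p
  have e := (IsLocalization.algEquiv p.asIdeal.primeCompl ((Spec A).presheaf.stalk p)
    (Localization.AtPrime p.asIdeal)).toRingEquiv
  exact ⟨fun h => ⟨‹_›, IsNormalDomain.of_ringEquiv e h⟩,
    fun ⟨_, h⟩ => IsNormalDomain.of_ringEquiv e.symm h⟩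

namespace QuadricPair

attribute [local instance] MvPolynomial.gradedAlgebra

section Point

variable {R : Type u} [CommRing R] (φ : QuadricPair R)

/-- The affine chart `x_j ≠ 0` of `{F = G = 0}`. -/
noncomputable def chartMap (j : Fin 4) : Spec (CommRingCat.of (φ.Chart j)) ⟶ φ.scheme :=
  Proj.awayι φ.grading (φ.toCoordRing (X j)) (φ.toCoordRing_X_mem j) one_pos

instance (j : Fin 4) : IsOpenImmersion (φ.chartMap j) :=
  inferInstanceAs (IsOpenImmersion (Proj.awayι _ _ _ _))

/-- The homogeneous ideal of a point of `{F = G = 0}`. -/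
noncomputable def pointIdeal (x : φ.scheme) : Ideal (MvPolynomial (Fin 4) R) :=
  (ProjectiveSpectrum.asHomogeneousIdeal (𝒜 := φ.grading) x).toIdeal.comap φ.toCoordRing

instance (x : φ.scheme) : (φ.pointIdeal x).IsPrime := by
  have := ProjectiveSpectrum.isPrime (𝒜 := φ.grading) x
  exact Ideal.comap_isPrime _ _

theorem mem_range_chartMap_iff (j : Fin 4) (x : φ.scheme) :
    x ∈ Set.range (φ.chartMap j) ↔ X j ∉ φ.pointIdeal x := by
  have h := Proj.opensRange_awayι φ.grading (φ.toCoordRing (X j)) (φ.toCoordRing_X_mem j) one_pos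
  have h' : x ∈ (φ.chartMap j).opensRange ↔ x ∈ Proj.basicOpen φ.grading (φ.toCoordRing (X j)) := by
    rw [← h]; rfl
  exact h'

theorem mem_pointIdeal_chartMap_iff_of_pos (j : Fin 4) (p : Spec (CommRingCat.of (φ.Chart j)))
    {a : MvPolynomial (Fin 4) R} {n : ℕ} (ha : a.IsHomogeneous n) (hn : 0 < n) :
    a ∈ φ.pointIdeal (φ.chartMap j p) ↔ φ.dehom j a ∈ p.asIdeal := by
  have h := Proj.awayι_preimage_basicOpen φ.grading (φ.toCoordRing_X_mem j) one_pos
    (φ.toCoordRing_mem_grading ha) hn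
  have h' : p ∈ φ.chartMap j ⁻¹ᵁ Proj.basicOpen φ.grading (φ.toCoordRing a) ↔
      p ∈ PrimeSpectrum.basicOpen (HomogeneousLocalization.Away.isLocalizationElem
        (φ.toCoordRing_X_mem j) (φ.toCoordRing_mem_grading ha)) := by
    rw [← h]; rfl
  have e : HomogeneousLocalization.Away.isLocalizationElem
        (φ.toCoordRing_X_mem j) (φ.toCoordRing_mem_grading ha) = φ.dehom j a := by
    rw [φ.dehom_eq_mk j ha]
    simp only [HomogeneousLocalization.Away.isLocalizationElem, pow_one]
  rw [e] at h'
  exact not_iff_not.mp h'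

theorem X_notMem_pointIdeal_chartMap (j : Fin 4) (p : Spec (CommRingCat.of (φ.Chart j))) :
    X j ∉ φ.pointIdeal (φ.chartMap j p) :=
  (φ.mem_range_chartMap_iff j _).mp ⟨p, rfl⟩

theorem mem_pointIdeal_chartMap_iff (j : Fin 4) (p : Spec (CommRingCat.of (φ.Chart j)))
    {a : MvPolynomial (Fin 4) R} {n : ℕ} (ha : a.IsHomogeneous n) :
    a ∈ φ.pointIdeal (φ.chartMap j p) ↔ φ.dehom j a ∈ p.asIdeal := by
  -- Multiplication by `X j`, which is 1 on the chart, brings degree 0 under the positive-degree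
  -- statement.
  have h := φ.mem_pointIdeal_chartMap_iff_of_pos j p ((isHomogeneous_X R j).mul ha) (by omega)
  rw [map_mul, dehom_X_self, one_mul] at h
  rw [← h]
  exact ⟨fun h => Ideal.mul_mem_left _ _ h, fun h =>
    (Ideal.IsPrime.mem_or_mem inferInstance h).resolve_left (φ.X_notMem_pointIdeal_chartMap j p)⟩

theorem exists_X_notMem_pointIdeal (x : φ.scheme) : ∃ j, X j ∉ φ.pointIdeal x := by
  by_contra! h
  refine ProjectiveSpectrum.not_irrelevant_le (𝒜 := φ.grading) x ?_
  intro s hs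
  obtain ⟨a, rfl⟩ := Ideal.Quotient.mk_surjective s
  change a ∈ φ.pointIdeal x
  -- The representative `a` may have a constant term, but its class has zero component in degree 0,
  -- so that term lies in the ideal.
  have h0 : C (a.coeff 0) ∈ φ.pointIdeal x := by
    have h1 := (HomogeneousIdeal.mem_irrelevant_iff _ _).mp hs
    rw [GradedRing.proj_apply] at h1
    have h2 := HomogQuot.preDecompose_apply (homogeneousSubmodule (Fin 4) R) φ.ideal a 0
    have h3 : φ.toCoordRing (C (a.coeff 0)) = 0 := by
      have h4 : ((DirectSum.decompose (homogeneousSubmodule (Fin 4) R) a 0 :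
          MvPolynomial (Fin 4) R)) = C (a.coeff 0) := by
        rw [← homogeneousComponent_zero]
        exact decomposition.decompose'_apply a 0
      rw [h4] at h2
      exact h2.symm.trans h1
    rw [pointIdeal, Ideal.mem_comap, h3]
    exact zero_mem _
  have hspan : a - C (a.coeff 0) ∈ Ideal.span (Set.range (X : Fin 4 → MvPolynomial (Fin 4) R)) := by
    rw [← Set.image_univ, mem_ideal_span_X_image]
    intro m hm
    by_contra! hm'
    obtain rfl : m = 0 := Finsupp.ext fun i => hm' i (Set.mem_univ i)
    simp [mem_support_iff] at hm
  have hle : Ideal.span (Set.range (X : Fin 4 → MvPolynomial (Fin 4) R)) ≤ φ.pointIdeal x := by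
    rw [Ideal.span_le]
    rintro _ ⟨j, rfl⟩
    exact h j
  simpa using add_mem (hle hspan) h0

theorem exists_chartMap_eq (x : φ.scheme) : ∃ j p, φ.chartMap j p = x := by
  obtain ⟨j, hj⟩ := φ.exists_X_notMem_pointIdeal x
  obtain ⟨p, hp⟩ := (φ.mem_range_chartMap_iff j x).mpr hj
  exact ⟨j, p, hp⟩

theorem chartMap_structureMap (j : Fin 4) :
    φ.chartMap j ≫ φ.structureMap = Spec.map (CommRingCat.ofHom (φ.chartScalar j)) := by
  rw [chartMap, structureMap]
  erw [Proj.awayι_toSpecZero_assoc]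
  rw [← Spec.map_comp]
  rfl

theorem schemeNormalAt_chartMap_iff (j : Fin 4) (p : Spec (CommRingCat.of (φ.Chart j))) :
    SchemeNormalAt φ.scheme (φ.chartMap j p) ↔ NormalAtPrime p.asIdeal := by
  rw [schemeNormalAt_iff_of_isOpenImmersion (φ.chartMap j), schemeNormalAt_spec_iff]

end Point

end QuadricPair

/-! ### Normality along the generic fibre, and the images of the fibres. -/

theorem schemeNormalAt_of_smooth {K : Type u} [Field K] {X : Scheme.{u}}
    (f : X ⟶ Spec (CommRingCat.of K)) [Smooth f] (x : X) : SchemeNormalAt X x := by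
  obtain ⟨_, ⟨V, hV, rfl⟩, hxV, -⟩ :=
    X.isBasis_affineOpens.exists_subset_of_mem_open (Set.mem_univ x) isOpen_univ
  have hs := f.smooth_appLE (isAffineOpen_top _) hV (le_top : V ≤ f ⁻¹ᵁ ⊤)
  have e := (Scheme.ΓSpecIso (CommRingCat.of K)).commRingCatIsoToRingEquiv
  let _ : Field Γ(Spec (CommRingCat.of K), ⊤) :=
    (MulEquiv.isField (Field.toIsField K) e.toMulEquiv).toField
  algebraize [(f.appLE ⊤ V le_top).hom]
  obtain ⟨y, rfl⟩ : x ∈ Set.range hV.fromSpec := by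
    rw [hV.range_fromSpec]; exact hxV
  have hV' : IsAffineOpen V := hV
  have : IsOpenImmersion (IsAffineOpen.fromSpec hV) := inferInstanceAs (IsOpenImmersion hV'.fromSpec)
  rw [schemeNormalAt_iff_of_isOpenImmersion, schemeNormalAt_spec_iff]
  have : Algebra.Smooth Γ(Spec (CommRingCat.of K), ⊤) Γ(X, V) := ‹_›
  have hy : y.asIdeal.IsPrime := y.isPrime
  exact ⟨hy, isNormalDomain_localization_of_smooth (k := Γ(Spec (CommRingCat.of K), ⊤)) _⟩

/-- Every nonzero element of `R` is a unit times a power of `t`, so inverting `t` is enough.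
Consequently the generic fibre is an open subscheme. -/
theorem isLocalizationAway_of_irreducible {R : Type u} [CommRing R] [IsDomain R]
    [IsDiscreteValuationRing R] {K : Type u} [Field K] [Algebra R K] [IsFractionRing R K]
    {t : R} (ht : Irreducible t) : IsLocalization.Away t K := by
  have hle : Submonoid.powers t ≤ nonZeroDivisors R := by
    rintro _ ⟨n, rfl⟩
    exact pow_mem (mem_nonZeroDivisors_of_ne_zero ht.ne_zero) n
  have : IsLocalization (nonZeroDivisors R) (Localization.Away t) := by
    refine IsLocalization.of_le_of_exists_dvd (Submonoid.powers t) _ hle fun r hr => ?_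
    obtain ⟨n, u, rfl⟩ := IsDiscreteValuationRing.eq_unit_mul_pow_irreducible
      (nonZeroDivisors.ne_zero hr) ht
    exact ⟨t ^ n, ⟨n, rfl⟩, ↑u⁻¹, by rw [mul_right_comm, Units.mul_inv, one_mul]⟩
  exact IsLocalization.isLocalization_of_algEquiv (Submonoid.powers t)
    (IsLocalization.algEquiv (nonZeroDivisors R) (Localization.Away t) K)

namespace QuadricPair

attribute [local instance] MvPolynomial.gradedAlgebra

section Fibers

variable {R : Type u} [CommRing R] (φ : QuadricPair R)

theorem chartMap_mem_range_fiberTo_iff (L : Type u) [CommRing L] [Algebra R L] (j : Fin 4)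
    (p : Spec (CommRingCat.of (φ.Chart j))) :
    φ.chartMap j p ∈ Set.range (φ.fiberTo L) ↔
      PrimeSpectrum.comap (φ.chartScalar j) p ∈
        Set.range (PrimeSpectrum.comap (algebraMap R L)) := by
  change φ.chartMap j p ∈ Set.range (pullback.fst φ.structureMap
    (Spec.map (CommRingCat.ofHom (algebraMap R L)))) ↔ _
  rw [Scheme.Pullback.range_fst, Set.mem_preimage, ← Scheme.Hom.comp_apply,
    chartMap_structureMap]
  rfl

theorem normalAtPrime_of_smooth_fiberStructureMap [IsDomain R] [IsDiscreteValuationRing R]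
    {K : Type u} [Field K] [Algebra R K] [IsFractionRing R K] {t : R} (ht : Irreducible t)
    (hsmooth : Smooth (φ.fiberStructureMap K)) (j : Fin 4) (p : Ideal (φ.Chart j)) [hp : p.IsPrime]
    (htp : φ.chartScalar j t ∉ p) : NormalAtPrime p := by
  have hloc : IsLocalization.Away t K := isLocalizationAway_of_irreducible ht
  have : IsOpenImmersion (Spec.map (CommRingCat.ofHom (algebraMap R K))) :=
    IsOpenImmersion.of_isLocalization t
  have : IsOpenImmersion (φ.fiberTo K) :=
    inferInstanceAs (IsOpenImmersion (pullback.fst φ.structureMap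
      (Spec.map (CommRingCat.ofHom (algebraMap R K)))))
  let x : Spec (CommRingCat.of (φ.Chart j)) := (⟨p, hp⟩ : PrimeSpectrum (φ.Chart j))
  have hx : φ.chartMap j x ∈ Set.range (φ.fiberTo K) := by
    rw [chartMap_mem_range_fiberTo_iff, PrimeSpectrum.localization_away_comap_range K t]
    exact htp
  obtain ⟨y, hy⟩ := hx
  have h := schemeNormalAt_of_smooth (φ.fiberStructureMap K) y
  rw [← schemeNormalAt_iff_of_isOpenImmersion (φ.fiberTo K), hy,
    schemeNormalAt_chartMap_iff] at h
  exact h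

variable [IsLocalRing R]

theorem mem_range_specialFiberTo_iff (j : Fin 4) (p : Spec (CommRingCat.of (φ.Chart j))) {t : R}
    (ht : IsLocalRing.maximalIdeal R = Ideal.span {t}) :
    φ.chartMap j p ∈ Set.range φ.specialFiberTo ↔ φ.chartScalar j t ∈ p.asIdeal := by
  rw [specialFiberTo, chartMap_mem_range_fiberTo_iff]
  have hsurj : Function.Surjective (algebraMap R (IsLocalRing.ResidueField R)) :=
    IsLocalRing.residue_surjective
  rw [range_comap_of_surjective _ _ hsurj, PrimeSpectrum.mem_zeroLocus]
  have hker : RingHom.ker (algebraMap R (IsLocalRing.ResidueField R)) = Ideal.span {t} := by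
    rw [← ht]; exact IsLocalRing.ker_residue
  rw [hker, SetLike.coe_subset_coe, Ideal.span_singleton_le_iff_mem]
  rfl

instance : IsClosedImmersion φ.specialFiberTo := by
  have : IsClosedImmersion
      (Spec.map (CommRingCat.ofHom (algebraMap R (IsLocalRing.ResidueField R)))) :=
    IsClosedImmersion.spec_of_surjective _ IsLocalRing.residue_surjective
  exact inferInstanceAs (IsClosedImmersion (pullback.fst φ.structureMap
    (Spec.map (CommRingCat.ofHom (algebraMap R (IsLocalRing.ResidueField R))))))

end Fibers

end QuadricPair

/-! ### Components of multiplicity one. -/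

/-- A section of `Y` that is not invertible at the image point pulls back into the maximal ideal of
the stalk of `X`, which is zero. -/
theorem germ_app_eq_zero_of_comp {X Y Z : Scheme.{u}} (h : Z ⟶ X) (f : X ⟶ Y) (η : Z)
    (hfield : ∀ c ∈ IsLocalRing.maximalIdeal (X.presheaf.stalk (h η)), c = 0) (U : Y.Opens)
    (s : Γ(Y, U)) (hη : (h ≫ f) η ∈ U) (hs : (h ≫ f) η ∉ Y.basicOpen s) :
    Z.presheaf.germ ((h ≫ f) ⁻¹ᵁ U) η hη ((h ≫ f).app U s) = 0 := by
  have hη' : f (h η) ∈ U := by rwa [Scheme.Hom.comp_apply] at hη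
  have hs' : h η ∉ X.basicOpen (f.app U s) := by
    rw [← Scheme.preimage_basicOpen]
    rwa [Scheme.Hom.comp_apply] at hs
  have h0 : X.presheaf.germ (f ⁻¹ᵁ U) (h η) hη' (f.app U s) = 0 := by
    refine hfield _ ((IsLocalRing.mem_maximalIdeal _).mpr fun hu => hs' ?_)
    exact (X.mem_basicOpen (f.app U s) (h η) hη').mpr hu
  have h1 := h.germ_stalkMap_apply (f ⁻¹ᵁ U) η hη' (f.app U s)
  rw [h0, map_zero] at h1
  rw [Scheme.Hom.comp_app]
  exact h1.symm

theorem germ_app_isOpenImmersion_comp {A B : CommRingCat.{u}} {Y : Scheme.{u}} (π : A ⟶ B)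
    (f : Spec A ⟶ Y) [IsOpenImmersion f] (b : A) (η : Spec B)
    (hb : b ∈ (Spec.map π η).asIdeal)
    (h : ∀ (U : Y.Opens) (s : Γ(Y, U)) (hη : (Spec.map π ≫ f) η ∈ U),
      (Spec.map π ≫ f) η ∉ Y.basicOpen s →
      (Spec B).presheaf.germ ((Spec.map π ≫ f) ⁻¹ᵁ U) η hη ((Spec.map π ≫ f).app U s) = 0) :
    (Spec B).presheaf.germ ⊤ η trivial ((Scheme.ΓSpecIso B).inv (π b)) = 0 := by
  -- An open immersion is an isomorphism onto its range, so the ring element `b` is the pullback of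
  -- a section `s` of `Y`, to which `h` applies.
  have : IsIso (f.app f.opensRange) := f.isIso_app _ le_rfl
  let V := f ⁻¹ᵁ f.opensRange
  let b' : Γ(Spec A, V) := (Spec A).presheaf.map (homOfLE le_top).op ((Scheme.ΓSpecIso A).inv b)
  let s : Γ(Y, f.opensRange) := inv (f.app f.opensRange) b'
  have hs : f.app f.opensRange s = b' := by
    simp only [s, ← CommRingCat.comp_apply, IsIso.inv_hom_id]
    rfl
  have hη : (Spec.map π ≫ f) η ∈ f.opensRange := by
    rw [Scheme.Hom.comp_apply]
    exact ⟨_, rfl⟩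
  have hns : (Spec.map π ≫ f) η ∉ Y.basicOpen s := by
    rw [Scheme.Hom.comp_apply]
    intro hmem
    have : Spec.map π η ∈ f ⁻¹ᵁ Y.basicOpen s := hmem
    rw [Scheme.preimage_basicOpen, hs, Scheme.basicOpen_res] at this
    have h2 := this.2
    rw [basicOpen_eq_of_affine] at h2
    exact h2 (by simpa using hb)
  have h0 := h _ s hη hns
  rw [Scheme.Hom.comp_app] at h0
  have e : ((f.app f.opensRange ≫ (Spec.map π).app V) s) =
      (Spec B).presheaf.map (homOfLE le_top).op ((Scheme.ΓSpecIso B).inv (π b)) := by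
    rw [CommRingCat.comp_apply, hs]
    have hnat := (Spec.map π).naturality (homOfLE (le_top : V ≤ ⊤)).op
    have h1 := congrArg (fun g => g.hom ((Scheme.ΓSpecIso A).inv b)) hnat
    have h2 := congrArg (fun g => g.hom b) (Scheme.ΓSpecIso_inv_naturality π)
    simp only [CommRingCat.hom_comp, RingHom.comp_apply] at h1 h2
    refine h1.trans ?_
    erw [← h2]
    rfl
  erw [e] at h0
  rw [← h0]
  exact ((Spec B).presheaf.germ_res_apply (homOfLE le_top) η _ _).symm

namespace QuadricPair

attribute [local instance] MvPolynomial.gradedAlgebra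

section Fibers

variable {R : Type u} [CommRing R] [IsLocalRing R] (φ : QuadricPair R)

/-- Length one makes the stalk of the special fibre at `ξ` a field. A morphism from the spectrum of
the chart modulo `t` to the special fibre carries this over: each `b` in `p` has zero germ modulo
`t`. No identification of that spectrum with an open part of the special fibre is needed. -/
theorem exists_dvd_of_lengthAt_eq_one {t : R} (ht : IsLocalRing.maximalIdeal R = Ideal.span {t})
    (ξ : φ.specialFiber) (hξ : lengthAt φ.specialFiber ξ = 1) (j : Fin 4)
    (p : Spec (CommRingCat.of (φ.Chart j))) (hp : φ.specialFiberTo ξ = φ.chartMap j p)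
    (b : φ.Chart j) (hb : b ∈ p.asIdeal) : ∃ s ∉ p.asIdeal, φ.chartScalar j t ∣ s * b := by
  have hfield : ∀ c ∈ IsLocalRing.maximalIdeal (φ.specialFiber.presheaf.stalk ξ), c = 0 := by
    have hsimple : IsSimpleModule (φ.specialFiber.presheaf.stalk ξ)
      (φ.specialFiber.presheaf.stalk ξ) := Module.length_eq_one_iff.mp hξ
    rcases eq_bot_or_eq_top (IsLocalRing.maximalIdeal (φ.specialFiber.presheaf.stalk ξ)) with h | h
    · intro c hc
      rwa [h] at hc
    · exact absurd h (Ideal.IsPrime.ne_top inferInstance)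
  have htp : φ.chartScalar j t ∈ p.asIdeal :=
    (φ.mem_range_specialFiberTo_iff j p ht).mp ⟨ξ, hp⟩
  let T := φ.Chart j ⧸ Ideal.span {φ.chartScalar j t}
  let π : φ.Chart j →+* T := Ideal.Quotient.mk _
  let σ : IsLocalRing.ResidueField R →+* T :=
    Ideal.Quotient.lift (IsLocalRing.maximalIdeal R) (π.comp (φ.chartScalar j)) fun r hr => by
      rw [ht, Ideal.mem_span_singleton] at hr
      obtain ⟨c, rfl⟩ := hr
      exact Ideal.Quotient.eq_zero_iff_mem.mpr
        (Ideal.mem_span_singleton.mpr (by rw [map_mul]; exact dvd_mul_right _ _))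
  have hcomm : (Spec.map (CommRingCat.ofHom π) ≫ φ.chartMap j) ≫ φ.structureMap =
      Spec.map (CommRingCat.ofHom σ) ≫
        Spec.map (CommRingCat.ofHom (algebraMap R (IsLocalRing.ResidueField R))) := by
    rw [Category.assoc, chartMap_structureMap, ← Spec.map_comp, ← Spec.map_comp]
    rfl
  let h : Spec (CommRingCat.of T) ⟶ φ.specialFiber := pullback.lift _ _ hcomm
  have hfac : h ≫ φ.specialFiberTo = Spec.map (CommRingCat.ofHom π) ≫ φ.chartMap j :=
    pullback.lift_fst _ _ _
  obtain ⟨η, hη⟩ : ∃ η : Spec (CommRingCat.of T), Spec.map (CommRingCat.ofHom π) η = p := by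
    have : p ∈ Set.range (PrimeSpectrum.comap π) := by
      rw [range_comap_of_surjective _ _ Ideal.Quotient.mk_surjective, Ideal.mk_ker]
      refine (PrimeSpectrum.mem_zeroLocus _ _).mpr ?_
      rw [SetLike.coe_subset_coe, Ideal.span_singleton_le_iff_mem]
      exact htp
    exact this
  have hh : h η = ξ := by
    apply φ.specialFiberTo.isClosedEmbedding.injective
    rw [hp, ← Scheme.Hom.comp_apply, hfac, Scheme.Hom.comp_apply, hη]
  subst hh
  have hz := germ_app_isOpenImmersion_comp (CommRingCat.ofHom π) (φ.chartMap j) b η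
    (by rwa [hη]) (by
      rw [← hfac]
      exact fun U s => germ_app_eq_zero_of_comp h φ.specialFiberTo η hfield U s)
  let _ : Algebra T ((Spec (CommRingCat.of T)).presheaf.stalk η) :=
    StructureSheaf.stalkAlgebra T η
  have hη' : η.asIdeal.IsPrime := η.isPrime
  have : IsLocalization.AtPrime ((Spec (CommRingCat.of T)).presheaf.stalk η) η.asIdeal :=
    StructureSheaf.IsLocalization.to_stalk T η
  have hz' : algebraMap T ((Spec (CommRingCat.of T)).presheaf.stalk η) (π b) = 0 := hz
  obtain ⟨⟨m, hm⟩, hm'⟩ := (IsLocalization.map_eq_zero_iff η.asIdeal.primeCompl _ _).mp hz'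
  obtain ⟨s, rfl⟩ := Ideal.Quotient.mk_surjective m
  refine ⟨s, fun hs => hm ?_, ?_⟩
  · rw [← hη] at hs
    exact hs
  · rw [← Ideal.mem_span_singleton]
    exact Ideal.Quotient.eq_zero_iff_mem.mp (by rw [map_mul]; exact hm')

end Fibers

end QuadricPair

/-! ### Proving and refuting normality at a prime through generators. -/

/-- The multipliers `s` become units in the local ring, whose maximal ideal is then generated by `π`
by Nakayama. -/
theorem normalAtPrime_of_forall_exists {B : Type*} [CommRing B] [IsNoetherianRing B] {p : Ideal B}
    [hp : p.IsPrime] {t π : B} (ht : t ∈ nonZeroDivisors B) (htp : t ∈ p) (hπ : π ∈ p) {S : Set B}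
    (hS : p = Ideal.span S) (h : ∀ b ∈ S, ∃ s ∉ p, s * b ∈ Ideal.span {π} ⊔ p ^ 2) :
    NormalAtPrime p := by
  let A := Localization.AtPrime p
  have hm : IsLocalRing.maximalIdeal A = p.map (algebraMap B A) :=
    (Localization.AtPrime.map_eq_maximalIdeal (I := p)).symm
  have hmem : ∀ x ∈ p, algebraMap B A x ∈ IsLocalRing.maximalIdeal A := fun x hx => by
    rw [hm]; exact Ideal.mem_map_of_mem _ hx
  refine ⟨hp, isNormalDomain_of_maximalIdeal_eq_span (t := algebraMap B A t)
    (π := algebraMap B A π) ?_ (hmem t htp) (maximalIdeal_eq_span_of_le_sup (hmem π hπ) ?_)⟩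
  · exact IsLocalization.map_nonZeroDivisors_le p.primeCompl A (Submonoid.mem_map_of_mem _ ht)
  · have hle : (Ideal.span {π} ⊔ p ^ 2).map (algebraMap B A) ≤
        Ideal.span {algebraMap B A π} ⊔ IsLocalRing.maximalIdeal A ^ 2 := by
      rw [Ideal.map_sup, Ideal.map_span, Set.image_singleton, Ideal.map_pow, hm]
    have hmap : p.map (algebraMap B A) = Ideal.span (algebraMap B A '' S) :=
      (congrArg (Ideal.map (algebraMap B A)) hS).trans (Ideal.map_span _ _)
    conv_lhs => rw [hm, hmap]
    rw [Ideal.span_le]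
    rintro _ ⟨b, hb, rfl⟩
    obtain ⟨s, hs, hsb⟩ := h b hb
    have h1 := hle (Ideal.mem_map_of_mem (algebraMap B A) hsb)
    rw [map_mul] at h1
    exact (Ideal.unit_mul_mem_iff_mem _
      (IsLocalization.map_units A (⟨s, hs⟩ : p.primeCompl))).mp h1

/-- Locally `p` is generated by `t` and `x`, so `h = t a + x b`, and `u * x ^ 2 = t * h` becomes an
integral equation for `x / t`. Normality puts `x / t` in the local ring. -/
theorem NormalAtPrime.exists_dvd_mul {B : Type*} [CommRing B] {p : Ideal B}
    (hN : NormalAtPrime p) {t x u h : B} (ht : t ∈ nonZeroDivisors B) (hu : u ∉ p) (hh : h ∈ p)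
    {S : Set B} (hS : p = Ideal.span S) (hSx : ∀ b ∈ S, ∃ s ∉ p, s * b ∈ Ideal.span {t, x})
    (heq : u * x ^ 2 = t * h) : ∃ s ∉ p, t ∣ s * x := by
  obtain ⟨hp, hA⟩ := hN
  let A := Localization.AtPrime p
  have hunit : ∀ s ∉ p, IsUnit (algebraMap B A s) := fun s hs =>
    IsLocalization.map_units A (⟨s, hs⟩ : p.primeCompl)
  have hle : p.map (algebraMap B A) ≤ Ideal.span {algebraMap B A t, algebraMap B A x} := by
    rw [(congrArg (Ideal.map (algebraMap B A)) hS).trans (Ideal.map_span _ _), Ideal.span_le]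
    rintro _ ⟨b, hb, rfl⟩
    obtain ⟨s, hs, hsb⟩ := hSx b hb
    have h1 := Ideal.mem_map_of_mem (algebraMap B A) hsb
    rw [map_mul, Ideal.map_span, Set.image_pair] at h1
    exact (Ideal.unit_mul_mem_iff_mem _ (hunit s hs)).mp h1
  obtain ⟨v, hv⟩ := hunit u hu
  obtain ⟨a, b, hab⟩ := Ideal.mem_span_pair.mp (hle (Ideal.mem_map_of_mem (algebraMap B A) hh))
  have hnt : Nontrivial A := hA.1.toNontrivial
  have ht0 : algebraMap B A t ≠ 0 := nonZeroDivisors.ne_zero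
    (IsLocalization.map_nonZeroDivisors_le p.primeCompl A (Submonoid.mem_map_of_mem _ ht))
  have heq' := congrArg (algebraMap B A) heq
  rw [map_mul, map_mul, map_pow, ← hv] at heq'
  obtain ⟨y, hy⟩ := dvd_of_sq_eq_mul hA (x := algebraMap B A x) (a := ↑v⁻¹ * a) (b := ↑v⁻¹ * b)
    ht0 (by
      rw [← Units.inv_mul_cancel_left v (algebraMap B A x ^ 2), heq', ← hab]
      ring)
  obtain ⟨⟨c, ⟨s, hs⟩⟩, hcs⟩ := IsLocalization.surj p.primeCompl y
  replace hcs : y * algebraMap B A s = algebraMap B A c := hcs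
  have : algebraMap B A (s * x) = algebraMap B A (t * c) := by
    rw [map_mul, map_mul, hy, ← hcs]; ring
  obtain ⟨⟨r, hr⟩, hrs⟩ := (IsLocalization.eq_iff_exists p.primeCompl A).mp this
  exact ⟨r * s, fun hm => (hp.mem_or_mem hm).elim hr hs, r * c, by
    simp only at hrs
    linear_combination hrs⟩

/-! ### Reduction modulo `t` and flatness. -/

theorem eq_mul_of_mul_add_mul_eq_zero {S : Type*} [CommRing S] [IsDomain S]
    [DecompositionMonoid S] {f g b c : S} (hfg : IsRelPrime f g) (hf : f ≠ 0)
    (h : b * f + c * g = 0) : ∃ e, b = g * e ∧ c = -(f * e) := by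
  have hdvd : f ∣ c := by
    refine hfg.dvd_of_dvd_mul_right (?_ : f ∣ c * g)
    exact ⟨-b, by linear_combination h⟩
  obtain ⟨e, rfl⟩ := hdvd
  refine ⟨-e, ?_, by ring⟩
  refine mul_left_cancel₀ hf ?_
  linear_combination h

namespace QuadricPair

attribute [local instance] MvPolynomial.gradedAlgebra

section Reduction

variable {R : Type u} [CommRing R] [IsLocalRing R] (φ : QuadricPair R)

/-- Reduction of polynomials to the residue field. -/
noncomputable abbrev red :
    MvPolynomial (Fin 4) R →+* MvPolynomial (Fin 4) (IsLocalRing.ResidueField R) :=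
  MvPolynomial.map (IsLocalRing.residue R)

theorem red_surjective : Function.Surjective (red (R := R)) :=
  map_surjective _ IsLocalRing.residue_surjective

theorem red_eq_zero_iff {t : R} (ht : IsLocalRing.maximalIdeal R = Ideal.span {t})
    (a : MvPolynomial (Fin 4) R) : red a = 0 ↔ C t ∣ a := by
  refine (C_dvd_iff_map_hom_eq_zero (IsLocalRing.residue R) t (fun r => ?_) a).symm
  rw [← Ideal.mem_span_singleton, ← ht, IsLocalRing.residue_eq_zero_iff]

theorem exists_eq_add_of_red_eq {t : R} (ht : IsLocalRing.maximalIdeal R = Ideal.span {t})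
    {a b : MvPolynomial (Fin 4) R} (h : red a = red b) : ∃ c, a = b + C t * c := by
  obtain ⟨c, hc⟩ := (red_eq_zero_iff ht (a - b)).mp (by rw [map_sub, h, sub_self])
  exact ⟨c, by rw [← hc]; ring⟩

theorem redG_isHomogeneous : φ.redG.IsHomogeneous 2 := φ.hG.map _

theorem redF_ne_zero (hcoprime : IsRelPrime φ.redF φ.redG) : φ.redF ≠ 0 := by
  intro h
  rw [h] at hcoprime
  have hu : IsUnit φ.redG := hcoprime (dvd_zero _) dvd_rfl
  have h0 := hu.map (constantCoeff (σ := Fin 4) (R := IsLocalRing.ResidueField R))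
  rw [constantCoeff_eq, φ.redG_isHomogeneous.coeff_eq_zero (by simp)] at h0
  exact not_isUnit_zero h0

theorem red_mem_span_iff {t : R} (ht : IsLocalRing.maximalIdeal R = Ideal.span {t})
    (a : MvPolynomial (Fin 4) R) :
    red a ∈ Ideal.span {φ.redF, φ.redG} ↔ ∃ c, a - C t * c ∈ Ideal.span {φ.F, φ.G} := by
  constructor
  · intro h
    obtain ⟨b', c', h⟩ := Ideal.mem_span_pair.mp h
    obtain ⟨b, rfl⟩ := red_surjective b'
    obtain ⟨c, rfl⟩ := red_surjective c'
    have h' : red a = red (b * φ.F + c * φ.G) := by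
      rw [map_add, map_mul, map_mul]; exact h.symm
    obtain ⟨e, he⟩ := exists_eq_add_of_red_eq ht h'
    exact ⟨e, Ideal.mem_span_pair.mpr ⟨b, c, by rw [he]; ring⟩⟩
  · rintro ⟨c, h⟩
    obtain ⟨b, e, h⟩ := Ideal.mem_span_pair.mp h
    have h' := congrArg red h
    have ht0 : red (C t * c) = 0 := (red_eq_zero_iff ht _).mpr (dvd_mul_right _ _)
    rw [map_add, map_mul, map_mul, map_sub, ht0, sub_zero] at h'
    exact Ideal.mem_span_pair.mpr ⟨_, _, h'⟩

/-- Modulo `t` the relation is a syzygy of two coprime forms, hence a multiple of the trivial one.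
Subtracting a lift of that multiple makes both coefficients divisible by `t`, which then cancels. -/
theorem mem_span_of_C_mul_mem [IsDomain R] {t : R} (ht0 : t ≠ 0)
    (ht : IsLocalRing.maximalIdeal R = Ideal.span {t})
    (hcoprime : IsRelPrime φ.redF φ.redG) {a : MvPolynomial (Fin 4) R}
    (h : C t * a ∈ Ideal.span {φ.F, φ.G}) : a ∈ Ideal.span {φ.F, φ.G} := by
  obtain ⟨b, c, h⟩ := Ideal.mem_span_pair.mp h
  have h' := congrArg red h
  rw [(red_eq_zero_iff ht _).mpr (dvd_mul_right _ _), map_add, map_mul, map_mul] at h'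
  obtain ⟨e', hb, hc⟩ := eq_mul_of_mul_add_mul_eq_zero hcoprime (φ.redF_ne_zero hcoprime) h'
  obtain ⟨e, rfl⟩ := red_surjective e'
  obtain ⟨b', rfl⟩ := exists_eq_add_of_red_eq ht (b := φ.G * e) (by rw [hb, map_mul]; rfl)
  obtain ⟨c', rfl⟩ := exists_eq_add_of_red_eq ht (b := -(φ.F * e)) (by
    rw [hc, map_neg, map_mul]; rfl)
  refine Ideal.mem_span_pair.mpr ⟨b', c', ?_⟩
  refine mul_left_cancel₀ (C_ne_zero.mpr ht0 : (C t : MvPolynomial (Fin 4) R) ≠ 0) ?_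
  linear_combination h

theorem chartScalar_mem_nonZeroDivisors [IsDomain R] {t : R} (ht0 : t ≠ 0)
    (ht : IsLocalRing.maximalIdeal R = Ideal.span {t})
    (hcoprime : IsRelPrime φ.redF φ.redG) (j : Fin 4) :
    φ.chartScalar j t ∈ nonZeroDivisors (φ.Chart j) := by
  rw [mem_nonZeroDivisors_iff_right]
  intro b hb
  obtain ⟨n, a, ha, rfl⟩ := φ.exists_dehom_eq j b
  rw [← dehom_C, ← map_mul, φ.dehom_eq_zero_iff j (ha.mul (isHomogeneous_C _ t))] at hb
  obtain ⟨m, hm⟩ := hb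
  refine (φ.dehom_eq_zero_iff j ha).mpr ⟨m, φ.mem_span_of_C_mul_mem ht0 ht hcoprime ?_⟩
  rwa [mul_left_comm, mul_comm (C t) a]

/-- Divisibility by `t` on a chart becomes ideal membership over the residue field, where the
primary decomposition is known. -/
theorem chartScalar_dvd_dehom_iff {t : R} (ht : IsLocalRing.maximalIdeal R = Ideal.span {t})
    (j : Fin 4) {a : MvPolynomial (Fin 4) R} {n : ℕ} (ha : a.IsHomogeneous n) :
    φ.chartScalar j t ∣ φ.dehom j a ↔
      ∃ m, X j ^ m * red a ∈ Ideal.span {φ.redF, φ.redG} := by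
  constructor
  · rintro ⟨b, hb⟩
    obtain ⟨k, b, hb', rfl⟩ := φ.exists_dehom_eq j b
    -- The powers of `X j` only equalise the degrees.
    have h0 : φ.dehom j (X j ^ k * a - X j ^ n * (C t * b)) = 0 := by
      simp [hb]
    have hhom : (X j ^ k * a - X j ^ n * (C t * b)).IsHomogeneous (k + n) := by
      have h1 := ((isHomogeneous_X R j).pow k).mul ha
      have h2 := ((isHomogeneous_X R j).pow n).mul ((isHomogeneous_C _ t).mul hb')
      rw [one_mul] at h1 h2
      rw [zero_add, add_comm n k] at h2
      exact h1.sub h2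
    obtain ⟨m, hm⟩ := (φ.dehom_eq_zero_iff j hhom).mp h0
    refine ⟨m + k, ?_⟩
    have := (φ.red_mem_span_iff ht (X j ^ (m + k) * a)).mpr ⟨X j ^ (m + n) * b, by
      convert hm using 1
      ring⟩
    simpa using this
  · rintro ⟨m, hm⟩
    have h1 : red (X j ^ m * a) = X j ^ m * red a := by simp
    rw [← h1, φ.red_mem_span_iff ht] at hm
    obtain ⟨c, hc⟩ := hm
    obtain ⟨b, e, h⟩ := Ideal.mem_span_pair.mp hc
    have h' := congrArg (φ.dehom j) h
    simp only [map_add, map_mul, dehom_F, dehom_G, mul_zero, map_sub, map_pow, dehom_X_self,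
      one_pow, one_mul, dehom_C] at h'
    exact ⟨φ.dehom j c, by linear_combination -h'⟩

/-- The point is the kernel of the map from the coordinate ring to the residue polynomials modulo
`P`; `X i` shows that it does not contain the irrelevant ideal. -/
theorem exists_point (P : Ideal (MvPolynomial (Fin 4) (IsLocalRing.ResidueField R)))
    [hP : P.IsPrime] (hhom : P.IsHomogeneous (homogeneousSubmodule (Fin 4) _))
    (hF : φ.redF ∈ P) (hG : φ.redG ∈ P) (i : Fin 4) (hi : X i ∉ P) :
    ∃ x : φ.scheme, φ.pointIdeal x = P.comap red := by
  have hle : φ.ideal.toIdeal ≤ P.comap red := by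
    change Ideal.span {φ.F, φ.G} ≤ _
    rw [Ideal.span_le]
    rintro _ (rfl | rfl)
    · exact hF
    · exact hG
  let ψ : φ.CoordRing →+* MvPolynomial (Fin 4) (IsLocalRing.ResidueField R) ⧸ P :=
    Ideal.Quotient.lift _ ((Ideal.Quotient.mk P).comp red) fun a ha =>
      Ideal.Quotient.eq_zero_iff_mem.mpr (hle ha)
  have hψ : ∀ a, φ.toCoordRing a ∈ RingHom.ker ψ ↔ red a ∈ P := fun a =>
    Ideal.Quotient.eq_zero_iff_mem
  let I : HomogeneousIdeal φ.grading :=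
    { toSubmodule := RingHom.ker ψ
      is_homogeneous' := by
        intro n x hx
        obtain ⟨a, rfl⟩ := Ideal.Quotient.mk_surjective x
        have h1 := HomogQuot.preDecompose_apply (homogeneousSubmodule (Fin 4) R) φ.ideal a n
        have h2 : ((DirectSum.decompose φ.grading (φ.toCoordRing a) n : φ.grading n) : φ.CoordRing) =
          φ.toCoordRing (DirectSum.decompose (homogeneousSubmodule (Fin 4) R) a n) := h1
        change ((DirectSum.decompose φ.grading (φ.toCoordRing a) n : φ.grading n) : φ.CoordRing) ∈ _
        rw [h2, hψ]
        have h3 : red (DirectSum.decompose (homogeneousSubmodule (Fin 4) R) a n :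
            MvPolynomial (Fin 4) R) = (DirectSum.decompose (homogeneousSubmodule (Fin 4) _)
              (red a) n : MvPolynomial (Fin 4) (IsLocalRing.ResidueField R)) := by
          have e1 : (DirectSum.decompose (homogeneousSubmodule (Fin 4) R) a n :
            MvPolynomial (Fin 4) R) = homogeneousComponent n a := decomposition.decompose'_apply a n
          have e2 : (DirectSum.decompose (homogeneousSubmodule (Fin 4) _) (red a) n :
            MvPolynomial (Fin 4) (IsLocalRing.ResidueField R)) = homogeneousComponent n (red a) :=
              decomposition.decompose'_apply (red a) n
          rw [e1, e2]
          ext d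
          simp only [coeff_map, coeff_homogeneousComponent]
          split_ifs <;> simp
        rw [h3]
        exact hhom n ((hψ a).mp hx) }
  refine ⟨(⟨I, RingHom.ker_isPrime ψ, fun hirr => hi ?_⟩ : ProjectiveSpectrum φ.grading), ?_⟩
  · have h1 : φ.toCoordRing (X i) ∈ I :=
      hirr (HomogeneousIdeal.mem_irrelevant_of_mem _ one_pos (φ.toCoordRing_X_mem i))
    have := (hψ _).mp h1
    simpa using this
  · ext a
    exact hψ a

end Reduction

end QuadricPair

/-! ### Primary pieces of the special fibre and the global criterion. -/

namespace QuadricPair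

attribute [local instance] MvPolynomial.gradedAlgebra

section Components

variable {R : Type u} [CommRing R] [IsLocalRing R] (φ : QuadricPair R)

/-- The ideal `p` of the `j`-th chart is the dehomogenisation of the preimage of the ideal `P` of
polynomials over the residue field. -/
def LiesOver (j : Fin 4) (p : Ideal (φ.Chart j))
    (P : Ideal (MvPolynomial (Fin 4) (IsLocalRing.ResidueField R))) : Prop :=
  ∀ ⦃n : ℕ⦄ ⦃a : MvPolynomial (Fin 4) R⦄, a.IsHomogeneous n → (φ.dehom j a ∈ p ↔ red a ∈ P)

variable {φ} {P I : Ideal (MvPolynomial (Fin 4) (IsLocalRing.ResidueField R))}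

theorem LiesOver.of_pointIdeal_eq {j : Fin 4} {p : Spec (CommRingCat.of (φ.Chart j))}
    (h : φ.pointIdeal (φ.chartMap j p) = P.comap red) : φ.LiesOver j p.asIdeal P := fun n a ha => by
  rw [← φ.mem_pointIdeal_chartMap_iff j p ha, h, Ideal.mem_comap]

theorem LiesOver.scalar_mem {j : Fin 4} {p : Ideal (φ.Chart j)} (h : φ.LiesOver j p P) {t : R}
    (ht : IsLocalRing.maximalIdeal R = Ideal.span {t}) : φ.chartScalar j t ∈ p := by
  rw [← dehom_C, h (isHomogeneous_C _ t)]
  have : red (C t : MvPolynomial (Fin 4) R) = 0 := (red_eq_zero_iff ht _).mpr dvd_rfl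
  rw [this]
  exact P.zero_mem

theorem LiesOver.eq_span {j : Fin 4} {p : Ideal (φ.Chart j)} (h : φ.LiesOver j p P) {t : R}
    (ht : IsLocalRing.maximalIdeal R = Ideal.span {t}) {T : Set (MvPolynomial (Fin 4) R)}
    (hT : ∀ a ∈ T, ∃ n, a.IsHomogeneous n) (hP : P = Ideal.span (red '' T)) :
    p = Ideal.span (insert (φ.chartScalar j t) (φ.dehom j '' T)) := by
  apply le_antisymm
  · intro b hb
    obtain ⟨n, a, ha, rfl⟩ := φ.exists_dehom_eq j b
    rw [h ha, hP, ← Ideal.map_span, Ideal.mem_map_iff_of_surjective _ red_surjective] at hb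
    obtain ⟨c, hc, hca⟩ := hb
    obtain ⟨e, rfl⟩ := exists_eq_add_of_red_eq ht hca.symm
    rw [map_add, map_mul, dehom_C]
    refine add_mem ?_ (Ideal.mul_mem_right _ _ (Ideal.subset_span (Set.mem_insert _ _)))
    refine Ideal.span_mono (Set.subset_insert _ _) ?_
    rw [← Ideal.map_span]
    exact Ideal.mem_map_of_mem _ hc
  · rw [Ideal.span_le]
    rintro _ (rfl | ⟨a, haT, rfl⟩)
    · exact h.scalar_mem ht
    · obtain ⟨n, ha⟩ := hT a haT
      refine (h ha).mpr ?_
      rw [hP]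
      exact Ideal.subset_span ⟨a, haT, rfl⟩

variable (φ)

/-- `I` contains the equations of the special fibre and is primary to the homogeneous prime `P`,
with the square of every element of `P` in `I`. -/
structure IsPrimaryPiece (P I : Ideal (MvPolynomial (Fin 4) (IsLocalRing.ResidueField R))) :
    Prop where
  isPrime : P.IsPrime
  isHomogeneous : P.IsHomogeneous (homogeneousSubmodule (Fin 4) _)
  le : I ≤ P
  span_le : Ideal.span {φ.redF, φ.redG} ≤ I
  mem_of_mul_mem : ∀ s a, s ∉ P → s * a ∈ I → a ∈ I
  sq_mem : ∀ z ∈ P, z ^ 2 ∈ I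

variable {φ}

theorem IsPrimaryPiece.redF_mem (h : φ.IsPrimaryPiece P I) : φ.redF ∈ P :=
  h.le (h.span_le (Ideal.subset_span (by simp)))

theorem IsPrimaryPiece.redG_mem (h : φ.IsPrimaryPiece P I) : φ.redG ∈ P :=
  h.le (h.span_le (Ideal.subset_span (by simp)))

theorem IsPrimaryPiece.exists_liesOver (h : φ.IsPrimaryPiece P I) (j : Fin 4) (hj : X j ∉ P) :
    ∃ p : Spec (CommRingCat.of (φ.Chart j)), φ.pointIdeal (φ.chartMap j p) = P.comap red ∧
      φ.LiesOver j p.asIdeal P := by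
  have := h.isPrime
  obtain ⟨x, hx⟩ := φ.exists_point P h.isHomogeneous h.redF_mem h.redG_mem j hj
  have hxj : X j ∉ φ.pointIdeal x := by
    rw [hx, Ideal.mem_comap]
    simpa using hj
  obtain ⟨p, rfl⟩ := (φ.mem_range_chartMap_iff j x).mpr hxj
  exact ⟨p, hx, .of_pointIdeal_eq hx⟩

/-- If the component passes through `q`, then `t` divides the form locally at its generic point, and
primariness removes the multiplier, so `z = 1` works. If it misses `q` or the whole chart, some form
in `P` is nonzero at `q`, and its square lies in `I`. -/
theorem IsPrimaryPiece.exists_mul_mem (h : φ.IsPrimaryPiece P I)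
    (hN : ∀ x : φ.scheme, φ.pointIdeal x = P.comap red → SchemeNormalAt φ.scheme x) {t : R}
    (ht : IsLocalRing.maximalIdeal R = Ideal.span {t}) (j : Fin 4) (q : Ideal (φ.Chart j))
    [hq : q.IsPrime] {a : MvPolynomial (Fin 4) R} {n : ℕ} (ha : a.IsHomogeneous n)
    (hb : ∀ p ≤ q, NormalAtPrime p → ∃ s ∉ p, φ.chartScalar j t ∣ s * φ.dehom j a) :
    ∃ m z, z.IsHomogeneous m ∧ φ.dehom j z ∉ q ∧ red z * red a ∈ I := by
  by_cases hj : X j ∈ P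
  · refine ⟨_, X j ^ 2, (isHomogeneous_X R j).pow 2, ?_, ?_⟩
    · rw [map_pow, dehom_X_self, one_pow]
      exact (Ideal.ne_top_iff_one q).mp hq.ne_top
    · simpa using Ideal.mul_mem_right _ _ (h.sq_mem _ hj)
  obtain ⟨p, hp, hpP⟩ := h.exists_liesOver j hj
  by_cases hpq : p.asIdeal ≤ q
  · obtain ⟨s, hs, hdvd⟩ := hb _ hpq ((φ.schemeNormalAt_chartMap_iff j p).mp (hN _ hp))
    obtain ⟨k, s, hsk, rfl⟩ := φ.exists_dehom_eq j s
    rw [hpP hsk] at hs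
    rw [← map_mul, φ.chartScalar_dvd_dehom_iff ht j (hsk.mul ha)] at hdvd
    obtain ⟨m, hm⟩ := hdvd
    refine ⟨0, 1, isHomogeneous_one _ _, ?_, ?_⟩
    · rw [map_one]
      exact (Ideal.ne_top_iff_one q).mp hq.ne_top
    · rw [map_one, one_mul]
      refine h.mem_of_mul_mem _ _ hs (h.mem_of_mul_mem (X j ^ m) _
        (fun hX => hj (h.isPrime.mem_of_pow_mem _ hX)) (h.span_le ?_))
      rwa [map_mul] at hm
  · obtain ⟨b, hbp, hbq⟩ := Set.not_subset.mp hpq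
    obtain ⟨k, z, hz, rfl⟩ := φ.exists_dehom_eq j b
    have hzP := (hpP hz).mp hbp
    refine ⟨_, z ^ 2, hz.pow 2, ?_, ?_⟩
    · rw [map_pow]
      exact fun hmem => hbq (hq.mem_of_pow_mem _ hmem)
    · rw [map_pow]
      exact Ideal.mul_mem_right _ _ (h.sq_mem _ hzP)

end Components

section Normal

variable {R : Type u} [CommRing R] [IsDomain R] [IsDiscreteValuationRing R] {φ : QuadricPair R}
  {P₁ I₁ P₂ I₂ : Ideal (MvPolynomial (Fin 4) (IsLocalRing.ResidueField R))}
  {K : Type u} [Field K] [Algebra R K] [IsFractionRing R K]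

/-- Each piece contributes a multiplier nonvanishing at `q`; their product carries the form into `I₁
⊓ I₂`, hence into the ideal of the special fibre. This is the divisibility test required by
`normalAtPrime_of_forall_le`. -/
theorem schemeNormal_of_isPrimaryPiece {t : R} (ht : Irreducible t)
    (hcoprime : IsRelPrime φ.redF φ.redG) (hsmooth : Smooth (φ.fiberStructureMap K))
    (h₁ : φ.IsPrimaryPiece P₁ I₁) (h₂ : φ.IsPrimaryPiece P₂ I₂)
    (hI : I₁ ⊓ I₂ ≤ Ideal.span {φ.redF, φ.redG})
    (hN₁ : ∀ x : φ.scheme, φ.pointIdeal x = P₁.comap red → SchemeNormalAt φ.scheme x)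
    (hN₂ : ∀ x : φ.scheme, φ.pointIdeal x = P₂.comap red → SchemeNormalAt φ.scheme x) :
    SchemeNormal φ.scheme := by
  intro x
  obtain ⟨j, q, rfl⟩ := φ.exists_chartMap_eq x
  rw [schemeNormalAt_chartMap_iff]
  have hq : q.asIdeal.IsPrime := q.isPrime
  refine normalAtPrime_of_forall_le
    (φ.chartScalar_mem_nonZeroDivisors ht.ne_zero ht.maximalIdeal_eq hcoprime j) q.asIdeal
    (fun p hp _ htp => φ.normalAtPrime_of_smooth_fiberStructureMap ht hsmooth j p htp)
    fun b hb => ?_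
  obtain ⟨n, a, ha, rfl⟩ := φ.exists_dehom_eq j b
  obtain ⟨m₁, z₁, hz₁, hq₁, hI₁⟩ := h₁.exists_mul_mem hN₁ ht.maximalIdeal_eq j q.asIdeal ha hb
  obtain ⟨m₂, z₂, hz₂, hq₂, hI₂⟩ := h₂.exists_mul_mem hN₂ ht.maximalIdeal_eq j q.asIdeal ha hb
  refine ⟨φ.dehom j z₁ * φ.dehom j z₂, fun h => (hq.mem_or_mem h).elim hq₁ hq₂, ?_⟩
  rw [← map_mul, ← map_mul,
    φ.chartScalar_dvd_dehom_iff ht.maximalIdeal_eq j ((hz₁.mul hz₂).mul ha)]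
  refine ⟨0, ?_⟩
  rw [pow_zero, one_mul, map_mul, map_mul]
  refine hI ⟨?_, ?_⟩
  · rw [show red z₁ * red z₂ * red a = red z₂ * (red z₁ * red a) by ring]
    exact Ideal.mul_mem_left _ _ hI₁
  · rw [mul_assoc]
    exact Ideal.mul_mem_left _ _ hI₂

theorem schemeNormalAt_of_lengthAt_eq_one {t : R} (ht : Irreducible t)
    (hcoprime : IsRelPrime φ.redF φ.redG) (ξ : φ.specialFiber)
    (hξ : lengthAt φ.specialFiber ξ = 1) : SchemeNormalAt φ.scheme (φ.specialFiberTo ξ) := by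
  obtain ⟨j, p, hp⟩ := φ.exists_chartMap_eq (φ.specialFiberTo ξ)
  rw [← hp, schemeNormalAt_chartMap_iff]
  have hprime : p.asIdeal.IsPrime := p.isPrime
  have htp : φ.chartScalar j t ∈ p.asIdeal :=
    (φ.mem_range_specialFiberTo_iff j p ht.maximalIdeal_eq).mp ⟨ξ, hp.symm⟩
  refine normalAtPrime_of_forall_exists
    (φ.chartScalar_mem_nonZeroDivisors ht.ne_zero ht.maximalIdeal_eq hcoprime j) htp htp
    (Ideal.span_eq p.asIdeal).symm fun b hb => ?_
  obtain ⟨s, hs, hdvd⟩ :=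
    φ.exists_dvd_of_lengthAt_eq_one ht.maximalIdeal_eq ξ hξ j p hp.symm b hb
  exact ⟨s, hs, Ideal.mem_sup_left (Ideal.mem_span_singleton.mpr hdvd)⟩

end Normal

end QuadricPair

/-! ### The primary ideal `(x ^ 2, y)`. -/

section PairIdeals

variable {A : Type*} [CommRing A]

theorem sq_mem_span_sq_pair {x y z : A} (hz : z ∈ Ideal.span {x, y}) :
    z ^ 2 ∈ Ideal.span {x ^ 2, y} := by
  obtain ⟨a, b, rfl⟩ := Ideal.mem_span_pair.mp hz
  exact Ideal.mem_span_pair.mpr ⟨a ^ 2, 2 * a * x * b + b ^ 2 * y, by ring⟩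

theorem span_sq_pair_le (x y : A) : Ideal.span {x ^ 2, y} ≤ Ideal.span {x, y} := by
  rw [Ideal.span_le]
  rintro _ (rfl | rfl)
  · exact Ideal.pow_mem_of_mem _ (Ideal.subset_span (by simp)) 2 two_pos
  · exact Ideal.subset_span (by simp)

variable [IsDomain A]

/-- Write `a = b x + c y`. Since `x` is prime and does not divide `y`, comparing coefficients modulo
`x` and cancelling `x` gives `s * b` in `(x, y)`. So `b` is in `(x, y)`, and `b x` in `(x ^ 2, y)`.
-/
theorem mem_span_sq_pair_of_mul_mem {x y s a : A} (hx : Prime x) (hxy : ¬ x ∣ y)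
    (hP : (Ideal.span {x, y}).IsPrime) (hs : s ∉ Ideal.span {x, y})
    (h : s * a ∈ Ideal.span {x ^ 2, y}) : a ∈ Ideal.span {x ^ 2, y} := by
  obtain ⟨b, c, rfl⟩ := Ideal.mem_span_pair.mp
    ((hP.mem_or_mem (span_sq_pair_le x y h)).resolve_left hs)
  obtain ⟨d, e, hde⟩ := Ideal.mem_span_pair.mp h
  obtain ⟨f, hf⟩ : x ∣ s * c - e := by
    refine (hx.dvd_or_dvd (?_ : x ∣ (s * c - e) * y)).resolve_right hxy
    exact ⟨d * x - s * b, by linear_combination -hde⟩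
  have hsb : s * b ∈ Ideal.span {x, y} := by
    refine Ideal.mem_span_pair.mpr ⟨d, -f, mul_left_cancel₀ hx.ne_zero ?_⟩
    linear_combination hde + y * hf
  obtain ⟨g, k, rfl⟩ := Ideal.mem_span_pair.mp ((hP.mem_or_mem hsb).resolve_left hs)
  exact Ideal.mem_span_pair.mpr ⟨g, k * x + c, by ring⟩

/-- Cancelling `x` would put 1 in `(x, y)`. This is what shows that `x / t` is missing from the
local ring. -/
theorem notMem_span_sq_pair {x y : A} (hx : Prime x) (hxy : ¬ x ∣ y)
    (hP : (Ideal.span {x, y}).IsPrime) : x ∉ Ideal.span {x ^ 2, y} := by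
  intro h
  obtain ⟨a, b, hab⟩ := Ideal.mem_span_pair.mp h
  obtain ⟨c, rfl⟩ : x ∣ b := by
    refine (hx.dvd_or_dvd (?_ : x ∣ b * y)).resolve_right hxy
    exact ⟨1 - a * x, by linear_combination hab⟩
  refine hP.ne_top ((Ideal.eq_top_iff_one _).mpr (Ideal.mem_span_pair.mpr ⟨a, c, ?_⟩))
  refine mul_left_cancel₀ hx.ne_zero ?_
  linear_combination hab

end PairIdeals

/-! ### Polynomial ideals and valuations of coefficients. -/

namespace MvPolynomial

theorem sub_aeval_mem {σ k : Type*} [CommRing k] (I : Ideal (MvPolynomial σ k))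
    (f : σ → MvPolynomial σ k) (hf : ∀ i, X i - f i ∈ I) (a : MvPolynomial σ k) :
    a - aeval f a ∈ I := by
  have h : (Ideal.Quotient.mkₐ k I).comp (aeval f) = Ideal.Quotient.mkₐ k I := by
    ext i
    simpa using ((Ideal.Quotient.eq (I := I)).mpr (hf i)).symm
  exact (Ideal.Quotient.eq (I := I)).mp (DFunLike.congr_fun h a).symm

/-- Setting the variable `X i` to zero. -/
noncomputable def zeroVar {σ k : Type*} [CommRing k] [DecidableEq σ] (i : σ) :
    MvPolynomial σ k →ₐ[k] MvPolynomial σ k :=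
  aeval (Function.update X i 0)

section ZeroVar

variable {σ k : Type*} [CommRing k] [DecidableEq σ]

@[simp] theorem zeroVar_X_self (i : σ) : zeroVar i (X i : MvPolynomial σ k) = 0 := by
  simp [zeroVar]

theorem zeroVar_X_of_ne {i j : σ} (h : j ≠ i) : zeroVar i (X j : MvPolynomial σ k) = X j := by
  simp [zeroVar, h]

theorem sub_zeroVar_mem (i : σ) (a : MvPolynomial σ k) :
    a - zeroVar i a ∈ Ideal.span {(X i : MvPolynomial σ k)} := by
  refine sub_aeval_mem _ _ (fun j => ?_) a
  by_cases h : j = i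
  · subst h
    simp
  · simp [h]

/-- Setting `X i = 0` changes a polynomial by a multiple of `X i` and fixes `Q`. -/
theorem mem_span_X_pair_iff {i : σ} {Q : MvPolynomial σ k} (hQ : zeroVar i Q = Q)
    (a : MvPolynomial σ k) : a ∈ Ideal.span {X i, Q} ↔ Q ∣ zeroVar i a := by
  constructor
  · intro h
    obtain ⟨b, c, rfl⟩ := Ideal.mem_span_pair.mp h
    simp [hQ]
  · rintro ⟨c, hc⟩
    obtain ⟨d, hd⟩ := Ideal.mem_span_singleton.mp (sub_zeroVar_mem i a)
    exact Ideal.mem_span_pair.mpr ⟨d, c, by linear_combination -hd - hc⟩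

theorem isPrime_span_X_pair {i : σ} {Q : MvPolynomial σ k} (hQ : zeroVar i Q = Q)
    (hprime : Prime Q) : (Ideal.span {X i, Q}).IsPrime := by
  have h : (Ideal.span {Q}).IsPrime := (Ideal.span_singleton_prime hprime.ne_zero).mpr hprime
  have heq : Ideal.span {X i, Q} = (Ideal.span {Q}).comap (zeroVar i) := by
    ext a
    rw [mem_span_X_pair_iff hQ, Ideal.mem_comap, Ideal.mem_span_singleton]
  rw [heq]
  exact Ideal.comap_isPrime _ _

end ZeroVar

/-- The form is linear in `X 3`, with coprime coefficients `X i` and `X 1 ^ 2`; this works in every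
characteristic. -/
theorem prime_sq_add_mul {k : Type*} [Field k] {i : Fin 4} (h1 : i ≠ 1) (h3 : i ≠ 3) :
    Prime (X 1 ^ 2 + X i * X 3 : MvPolynomial (Fin 4) k) := by
  rw [add_comm]
  refine (irreducible_mul_X_add _ _ _ (X_ne_zero i) ?_ ?_ ?_).prime
  · simpa [vars_X] using h3.symm
  · intro h
    have := vars_pow (X 1 : MvPolynomial (Fin 4) k) 2 h
    simp [vars_X] at this
  · have hX : Prime (X i : MvPolynomial (Fin 4) k) := X_prime
    refine hX.irreducible.isRelPrime_iff_not_dvd.mpr fun h => ?_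
    have := hX.dvd_of_dvd_pow h
    rw [X_dvd_X] at this
    exact h1 this

theorem notMem_span_pair_of_eval {σ k : Type*} [CommRing k] {x y z : MvPolynomial σ k}
    (v : σ → k) (hx : eval v x = 0) (hy : eval v y = 0) (hz : eval v z ≠ 0) :
    z ∉ Ideal.span {x, y} := by
  intro h
  obtain ⟨a, b, rfl⟩ := Ideal.mem_span_pair.mp h
  simp [hx, hy] at hz

theorem exists_eq_C_mul_of_dvd {σ k : Type*} [Field k] {f g : MvPolynomial σ k} {n : ℕ}
    (hf : f.IsHomogeneous n) (hg : g.IsHomogeneous n) (hdvd : g ∣ f) : ∃ c, f = C c * g := by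
  by_cases hf0 : f = 0
  · exact ⟨0, by simp [hf0]⟩
  obtain ⟨e, rfl⟩ := hdvd
  have hg0 := left_ne_zero_of_mul hf0
  have he0 := right_ne_zero_of_mul hf0
  have h := totalDegree_mul_of_isDomain hg0 he0
  rw [hf.totalDegree hf0, hg.totalDegree hg0] at h
  have he := totalDegree_eq_zero_iff_eq_C.mp (by omega : e.totalDegree = 0)
  exact ⟨_, by rw [← he, mul_comm]⟩

theorem IsHomogeneous.of_C_mul {σ R : Type*} [CommRing R] [IsDomain R] {r : R} (hr : r ≠ 0)
    {a : MvPolynomial σ R} {n : ℕ} (h : (C r * a).IsHomogeneous n) : a.IsHomogeneous n := by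
  intro d hd
  refine h (d := d) ?_
  rw [coeff_C_mul]
  exact mul_ne_zero hr hd

theorem IsHomogeneous.rename_mem_span_pair_sq {k : Type*} [CommRing k]
    {q : MvPolynomial (Fin 2) k} (hq : q.IsHomogeneous 2) :
    rename ![0, 1] q ∈ (Ideal.span {X 0, X 1} : Ideal (MvPolynomial (Fin 4) k)) ^ 2 := by
  have h : q ∈ idealOfVars (Fin 2) k ^ 2 := by
    rw [mem_pow_idealOfVars_iff']
    intro d hd
    exact hq.coeff_eq_zero (by omega)
  have h' := Ideal.mem_map_of_mem (rename ![(0 : Fin 4), 1]) h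
  rw [Ideal.map_pow] at h'
  refine Ideal.pow_right_mono ?_ 2 h'
  rw [idealOfVars, Ideal.map_span, Ideal.span_le]
  rintro _ ⟨_, ⟨i, rfl⟩, rfl⟩
  refine Ideal.subset_span ?_
  fin_cases i <;> simp

end MvPolynomial

theorem polyVal_C_mul_eq_one_iff {R : Type u} [CommRing R] [IsDomain R]
    [IsDiscreteValuationRing R] {t : R} (ht : Irreducible t) (h : MvPolynomial (Fin 4) R) :
    polyVal (C t * h) = 1 ↔ ¬ C t ∣ h := by
  have hv : ∀ d, IsDiscreteValuationRing.addVal R ((C t * h).coeff d) =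
      1 + IsDiscreteValuationRing.addVal R (h.coeff d) := fun d => by
    rw [coeff_C_mul, IsDiscreteValuationRing.addVal_mul,
      IsDiscreteValuationRing.addVal_uniformizer ht]
  have hdvd : ∀ r : R, t ∣ r ↔ 1 ≤ IsDiscreteValuationRing.addVal R r := fun r => by
    rw [← IsDiscreteValuationRing.addVal_le_iff_dvd, IsDiscreteValuationRing.addVal_uniformizer ht]
  rw [C_dvd_iff_dvd_coeff]
  constructor
  · intro h1 h2
    have : (2 : ℕ∞) ≤ polyVal (C t * h) := le_iInf fun d => by
      rw [hv, ← one_add_one_eq_two]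
      exact add_le_add le_rfl ((hdvd _).mp (h2 d))
    rw [h1] at this
    exact absurd this (by decide)
  · intro h1
    push Not at h1
    obtain ⟨d, hd⟩ := h1
    rw [hdvd, not_le, Order.lt_one_iff] at hd
    apply le_antisymm
    · refine (iInf_le _ d).trans ?_
      rw [hv, hd, add_zero]
    · exact le_iInf fun d => by
        rw [hv]
        exact le_self_add

/-! ### Normality at the generic point of a double or reduced component. -/

namespace QuadricPair

attribute [local instance] MvPolynomial.gradedAlgebra

section LocalRing

variable {R : Type u} [CommRing R] [IsLocalRing R] {φ : QuadricPair R}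
  {P : Ideal (MvPolynomial (Fin 4) (IsLocalRing.ResidueField R))}

theorem isHomogeneous_span_pair {x y : MvPolynomial (Fin 4) (IsLocalRing.ResidueField R)} {m n : ℕ}
    (hx : x.IsHomogeneous m) (hy : y.IsHomogeneous n) :
    (Ideal.span {x, y}).IsHomogeneous (homogeneousSubmodule (Fin 4) (IsLocalRing.ResidueField R)) :=
  Ideal.homogeneous_span _ _ (by
    rintro _ (rfl | rfl)
    · exact ⟨_, hx⟩
    · exact ⟨_, hy⟩)

theorem span_redF_redG_le {I : Ideal (MvPolynomial (Fin 4) (IsLocalRing.ResidueField R))}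
    (hF : φ.redF ∈ I) (hG : φ.redG ∈ I) : Ideal.span {φ.redF, φ.redG} ≤ I := by
  rw [Ideal.span_le]
  rintro _ (rfl | rfl)
  · exact hF
  · exact hG

theorem IsPrimaryPiece.of_isPrime (hP : P.IsPrime)
    (hhom : P.IsHomogeneous (homogeneousSubmodule (Fin 4) _)) (hF : φ.redF ∈ P)
    (hG : φ.redG ∈ P) : φ.IsPrimaryPiece P P where
  isPrime := hP
  isHomogeneous := hhom
  le := le_rfl
  span_le := span_redF_redG_le hF hG
  mem_of_mul_mem _ _ hs h := (hP.mem_or_mem h).resolve_left hs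
  sq_mem _ hz := Ideal.pow_mem_of_mem _ hz 2 two_pos

theorem IsPrimaryPiece.of_prime {x y : MvPolynomial (Fin 4) (IsLocalRing.ResidueField R)} {m n : ℕ}
    (hx : x.IsHomogeneous m) (hy : y.IsHomogeneous n) (hxp : Prime x) (hxy : ¬ x ∣ y)
    (hP : (Ideal.span {x, y}).IsPrime) (hF : φ.redF ∈ Ideal.span {x ^ 2, y})
    (hG : φ.redG ∈ Ideal.span {x ^ 2, y}) :
    φ.IsPrimaryPiece (Ideal.span {x, y}) (Ideal.span {x ^ 2, y}) where
  isPrime := hP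
  isHomogeneous := isHomogeneous_span_pair hx hy
  le := span_sq_pair_le x y
  span_le := span_redF_redG_le hF hG
  mem_of_mul_mem _ _ hs h := mem_span_sq_pair_of_mul_mem hxp hxy hP hs h
  sq_mem _ hz := sq_mem_span_sq_pair hz

theorem exists_liesOver_of_pointIdeal_eq {j : Fin 4} (hj : X j ∉ P) {x : φ.scheme}
    (hx : φ.pointIdeal x = P.comap red) :
    ∃ p : Spec (CommRingCat.of (φ.Chart j)), φ.chartMap j p = x ∧ φ.LiesOver j p.asIdeal P := by
  have hxj : X j ∉ φ.pointIdeal x := by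
    rw [hx, Ideal.mem_comap]
    simpa using hj
  obtain ⟨p, rfl⟩ := (φ.mem_range_chartMap_iff j x).mpr hxj
  exact ⟨p, rfl, .of_pointIdeal_eq hx⟩

/-- As `t` divides `y`, the maximal ideal of the local ring is `(t, x)`. If `H` is a unit there, `x
^ 2 = t * H` puts `t` in `(x)`. If `H` is in `p`, normality would force `t` to divide `x` locally,
contradicting `notMem_span_sq_pair`. -/
theorem normalAtPrime_iff_of_sq_eq {x y H : MvPolynomial (Fin 4) R} {m n l : ℕ}
    (hx : x.IsHomogeneous m) (hy : y.IsHomogeneous n) (hH : H.IsHomogeneous l)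
    (hxp : Prime (red x)) (hxy : ¬ red x ∣ red y)
    (h : φ.IsPrimaryPiece (Ideal.span {red x, red y}) (Ideal.span {red x ^ 2, red y}))
    [IsNoetherianRing R] {t : R} (ht : IsLocalRing.maximalIdeal R = Ideal.span {t}) {j : Fin 4}
    (htnz : φ.chartScalar j t ∈ nonZeroDivisors (φ.Chart j))
    (hj : X j ∉ Ideal.span {red x, red y}) {p : Ideal (φ.Chart j)} [hpp : p.IsPrime]
    (hp : φ.LiesOver j p (Ideal.span {red x, red y})) (hyt : φ.chartScalar j t ∣ φ.dehom j y)
    (hxt : φ.dehom j x ^ 2 = φ.chartScalar j t * φ.dehom j H) :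
    NormalAtPrime p ↔ red H ∉ Ideal.span {red x, red y} := by
  have hspan := hp.eq_span ht (T := {x, y})
    (by rintro _ (rfl | rfl); exacts [⟨_, hx⟩, ⟨_, hy⟩]) (by rw [Set.image_pair])
  rw [Set.image_pair] at hspan
  have h1 : (1 : φ.Chart j) ∉ p := (Ideal.ne_top_iff_one p).mp hpp.ne_top
  rw [← hp hH]
  constructor
  · intro hN hHp
    obtain ⟨s, hs, hdvd⟩ := hN.exists_dvd_mul (u := 1) (x := φ.dehom j x) htnz h1 hHp hspan (by
      rintro _ (rfl | rfl | rfl)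
      · exact ⟨1, h1, by rw [one_mul]; exact Ideal.subset_span (by simp)⟩
      · exact ⟨1, h1, by rw [one_mul]; exact Ideal.subset_span (by simp)⟩
      · refine ⟨1, h1, ?_⟩
        rw [one_mul]
        exact Ideal.span_mono (by simp) (Ideal.mem_span_singleton.mpr hyt))
      (by rw [one_mul, hxt])
    obtain ⟨k, s, hsk, rfl⟩ := φ.exists_dehom_eq j s
    rw [hp hsk] at hs
    rw [← map_mul, φ.chartScalar_dvd_dehom_iff ht j (hsk.mul hx)] at hdvd
    obtain ⟨i, hi⟩ := hdvd
    rw [map_mul] at hi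
    exact notMem_span_sq_pair hxp hxy h.isPrime (h.mem_of_mul_mem _ _ hs (h.mem_of_mul_mem _ _
      (fun hX => hj (h.isPrime.mem_of_pow_mem _ hX)) (h.span_le hi)))
  · intro hHp
    have hxmem : φ.dehom j x ∈ p := (hp hx).mpr (Ideal.subset_span (by simp))
    have hht : φ.dehom j H * φ.chartScalar j t ∈ Ideal.span {φ.dehom j x} :=
      Ideal.mem_span_singleton.mpr ⟨φ.dehom j x, by rw [mul_comm, ← hxt, sq]⟩
    refine normalAtPrime_of_forall_exists htnz (hp.scalar_mem ht) hxmem hspan ?_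
    rintro _ (rfl | rfl | rfl)
    · exact ⟨_, hHp, Ideal.mem_sup_left hht⟩
    · exact ⟨1, h1, by
        rw [one_mul]; exact Ideal.mem_sup_left (Ideal.mem_span_singleton_self _)⟩
    · obtain ⟨e, he⟩ := hyt
      refine ⟨_, hHp, Ideal.mem_sup_left ?_⟩
      rw [he, ← mul_assoc]
      exact Ideal.mul_mem_right _ _ hht

theorem forall_schemeNormalAt_iff_of_sq_eq {x y H : MvPolynomial (Fin 4) R} {m n l : ℕ}
    (hx : x.IsHomogeneous m) (hy : y.IsHomogeneous n) (hH : H.IsHomogeneous l)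
    (hxp : Prime (red x)) (hxy : ¬ red x ∣ red y)
    (h : φ.IsPrimaryPiece (Ideal.span {red x, red y}) (Ideal.span {red x ^ 2, red y}))
    [IsNoetherianRing R] {t : R} (ht : IsLocalRing.maximalIdeal R = Ideal.span {t}) {j : Fin 4}
    (htnz : φ.chartScalar j t ∈ nonZeroDivisors (φ.Chart j))
    (hj : X j ∉ Ideal.span {red x, red y}) (hyt : φ.chartScalar j t ∣ φ.dehom j y)
    (hxt : φ.dehom j x ^ 2 = φ.chartScalar j t * φ.dehom j H) :
    (∀ z : φ.scheme, φ.pointIdeal z = (Ideal.span {red x, red y}).comap red →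
      SchemeNormalAt φ.scheme z) ↔ red H ∉ Ideal.span {red x, red y} := by
  have key : ∀ p : Spec (CommRingCat.of (φ.Chart j)),
      φ.LiesOver j p.asIdeal (Ideal.span {red x, red y}) →
      (SchemeNormalAt φ.scheme (φ.chartMap j p) ↔ red H ∉ Ideal.span {red x, red y}) := by
    intro p hp
    have : p.asIdeal.IsPrime := p.isPrime
    rw [schemeNormalAt_chartMap_iff]
    exact normalAtPrime_iff_of_sq_eq hx hy hH hxp hxy h ht htnz hj hp hyt hxt
  constructor
  · intro hN
    obtain ⟨p, hz, hp⟩ := h.exists_liesOver j hj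
    exact (key p hp).mp (hN _ hz)
  · intro hHP z hz
    obtain ⟨p, rfl, hp⟩ := exists_liesOver_of_pointIdeal_eq hj hz
    exact (key p hp).mpr hHP

/-- Here `t` alone generates `p`; this handles the reduced conic in (ii). -/
theorem forall_schemeNormalAt_of_dvd {x y : MvPolynomial (Fin 4) R} {m n : ℕ}
    (hx : x.IsHomogeneous m) (hy : y.IsHomogeneous n)
    [IsNoetherianRing R] {t : R} (ht : IsLocalRing.maximalIdeal R = Ideal.span {t}) {j : Fin 4}
    (htnz : φ.chartScalar j t ∈ nonZeroDivisors (φ.Chart j))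
    (hj : X j ∉ Ideal.span {red x, red y}) (hxt : φ.chartScalar j t ∣ φ.dehom j x)
    (hyt : φ.chartScalar j t ∣ φ.dehom j y) :
    ∀ z : φ.scheme, φ.pointIdeal z = (Ideal.span {red x, red y}).comap red →
      SchemeNormalAt φ.scheme z := by
  intro z hz
  obtain ⟨p, rfl, hp⟩ := exists_liesOver_of_pointIdeal_eq hj hz
  have hprime : p.asIdeal.IsPrime := p.isPrime
  rw [schemeNormalAt_chartMap_iff]
  have hspan := hp.eq_span ht (T := {x, y})
    (by rintro _ (rfl | rfl); exacts [⟨_, hx⟩, ⟨_, hy⟩]) (by rw [Set.image_pair])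
  rw [Set.image_pair] at hspan
  have h1 : (1 : φ.Chart j) ∉ p.asIdeal := (Ideal.ne_top_iff_one _).mp hprime.ne_top
  refine normalAtPrime_of_forall_exists htnz (hp.scalar_mem ht) (hp.scalar_mem ht) hspan ?_
  intro b hb
  refine ⟨1, h1, Ideal.mem_sup_left (Ideal.mem_span_singleton.mpr ?_)⟩
  rw [one_mul]
  obtain rfl | rfl | rfl := hb
  exacts [dvd_rfl, hxt, hyt]

end LocalRing

end QuadricPair

/-! ### The conic with a double line, and the double conic. -/

namespace QuadricPair

attribute [local instance] MvPolynomial.gradedAlgebra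

section Equations

variable {R : Type u} [CommRing R] [IsDomain R] [IsDiscreteValuationRing R] {φ : QuadricPair R}
  {t : R}

theorem exists_isHomogeneous_eq_add (ht : Irreducible t) {f a : MvPolynomial (Fin 4) R} {n : ℕ}
    (hf : f.IsHomogeneous n) (ha : a.IsHomogeneous n) (h : red f = red a) :
    ∃ c, c.IsHomogeneous n ∧ f = a + C t * c := by
  obtain ⟨c, hc⟩ := exists_eq_add_of_red_eq ht.maximalIdeal_eq h
  refine ⟨c, .of_C_mul ht.ne_zero ?_, hc⟩
  rw [show C t * c = f - a by rw [hc]; ring]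
  exact hf.sub ha

theorem red_restrictLine (f : MvPolynomial (Fin 4) R) :
    red (restrictLine f) = restrictLine (red f) := by
  have h : (red (R := R)).comp (aeval ![0, 0, X 2, X 3] :
      MvPolynomial (Fin 4) R →ₐ[R] _).toRingHom = (aeval ![0, 0, X 2, X 3] :
      MvPolynomial (Fin 4) (IsLocalRing.ResidueField R) →ₐ[IsLocalRing.ResidueField R]
        _).toRingHom.comp red := by
    ext i
    · simp
    · fin_cases i <;> simp
  exact DFunLike.congr_fun h f

theorem red_restrictPlane (f : MvPolynomial (Fin 4) R) :
    red (restrictPlane f) = restrictPlane (red f) := by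
  have h : (red (R := R)).comp (aeval ![0, X 1, X 2, X 3] :
      MvPolynomial (Fin 4) R →ₐ[R] _).toRingHom = (aeval ![0, X 1, X 2, X 3] :
      MvPolynomial (Fin 4) (IsLocalRing.ResidueField R) →ₐ[IsLocalRing.ResidueField R]
        _).toRingHom.comp red := by
    ext i
    · simp
    · fin_cases i <;> simp
  exact DFunLike.congr_fun h f

end Equations

section Restrict

variable {k : Type u} [CommRing k]

theorem restrictPlane_eq_zeroVar (f : MvPolynomial (Fin 4) k) :
    restrictPlane f = zeroVar 0 f := by
  rw [restrictPlane, zeroVar]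
  congr 2
  funext i
  fin_cases i <;> simp

theorem restrictLine_eq_zero_iff {f : MvPolynomial (Fin 4) k} :
    restrictLine f = 0 ↔ f ∈ Ideal.span {X 0, X 1} := by
  constructor
  · intro h
    have := sub_aeval_mem (Ideal.span {X 0, X 1}) ![0, 0, X 2, X 3] (fun i => by
      fin_cases i
      · exact Ideal.subset_span (by simp)
      · exact Ideal.subset_span (by simp)
      · simp
      · simp) f
    rw [← restrictLine, h, sub_zero] at this
    exact this
  · intro h
    obtain ⟨a, b, rfl⟩ := Ideal.mem_span_pair.mp h
    simp [restrictLine]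

end Restrict

section Line

variable {k : Type*} [Field k]

theorem isPrime_span_X_zero_X_one :
    (Ideal.span {X 0, X 1} : Ideal (MvPolynomial (Fin 4) k)).IsPrime :=
  isPrime_span_X_pair (zeroVar_X_of_ne (by decide)) X_prime

theorem isPrime_span_X_one_X_zero :
    (Ideal.span {X 1, X 0} : Ideal (MvPolynomial (Fin 4) k)).IsPrime :=
  isPrime_span_X_pair (zeroVar_X_of_ne (by decide)) X_prime

end Line

section Normal

variable {R : Type u} [CommRing R] [IsDomain R] [IsDiscreteValuationRing R] {φ : QuadricPair R}
  {K : Type u} [Field K] [Algebra R K] [IsFractionRing R K] {t : R}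

theorem schemeNormal_iff_of_conic_doubleLine (ht : Irreducible t)
    (hcoprime : IsRelPrime φ.redF φ.redG) (hsmooth : Smooth (φ.fiberStructureMap K))
    (hF : φ.redF = X 0 * X 2) (hG : φ.redG = X 1 ^ 2 + X 0 * X 3) :
    SchemeNormal φ.scheme ↔ polyVal (X 3 * restrictLine φ.F - X 2 * restrictLine φ.G) = 1 := by
  have hX := isHomogeneous_X R (σ := Fin 4)
  obtain ⟨F₁, hF₁, hF'⟩ := exists_isHomogeneous_eq_add ht φ.hF ((hX 0).mul (hX 2))
    (by rw [map_mul, map_X, map_X]; exact hF)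
  obtain ⟨G₁, hG₁, hG'⟩ := exists_isHomogeneous_eq_add ht φ.hG
    (((hX 1).pow 2).add ((hX 0).mul (hX 3)))
    (by rw [map_add, map_mul, map_pow, map_X, map_X, map_X]; exact hG)
  have hH : (X 3 * F₁ - X 2 * G₁).IsHomogeneous (1 + 2) := ((hX 3).mul hF₁).sub ((hX 2).mul hG₁)
  have hpoly : X 3 * restrictLine φ.F - X 2 * restrictLine φ.G =
      C t * restrictLine (X 3 * F₁ - X 2 * G₁) := by
    rw [hF', hG']
    simp [restrictLine]
    ring
  have hxp : Prime (red (X 1 : MvPolynomial (Fin 4) R)) := by rw [map_X]; exact X_prime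
  have hxy : ¬ red (X 1 : MvPolynomial (Fin 4) R) ∣ red (X 0) := by
    rw [map_X, map_X, X_dvd_X]; decide
  have hL : φ.IsPrimaryPiece (Ideal.span {red (X 1), red (X 0)})
      (Ideal.span {red (X 1) ^ 2, red (X 0)}) := by
    refine .of_prime ((hX 1).map _) ((hX 0).map _) hxp hxy ?_ ?_ ?_
    · rw [map_X, map_X]; exact isPrime_span_X_one_X_zero
    · rw [hF, map_X, map_X]
      exact Ideal.mem_span_pair.mpr ⟨0, X 2, by ring⟩
    · rw [hG, map_X, map_X]
      exact Ideal.mem_span_pair.mpr ⟨1, X 3, by ring⟩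
  have htnz := φ.chartScalar_mem_nonZeroDivisors ht.ne_zero ht.maximalIdeal_eq hcoprime
  have eF := fun j => φ.dehom_F j
  have eG := fun j => φ.dehom_G j
  rw [hF'] at eF
  rw [hG'] at eG
  simp only [map_add, map_mul, map_pow, dehom_C] at eF eG
  -- On the chart `X 2 = 1`, `F = 0` reads `X 0 = -t F₁`, and substituting in `G = 0` gives `X 1 ^ 2
  -- = t (X 3 F₁ - G₁)`.
  have hN := forall_schemeNormalAt_iff_of_sq_eq (j := 2) (hX 1) (hX 0) hH hxp hxy hL
    ht.maximalIdeal_eq (htnz 2)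
    (by
      rw [map_X, map_X]
      exact notMem_span_pair_of_eval (Pi.single 2 1) (by simp) (by simp) (by simp))
    ⟨-φ.dehom 2 F₁, by
      have := eF 2
      rw [dehom_X_self] at this
      linear_combination this⟩
    (by
      have h1 := eF 2
      have h2 := eG 2
      rw [map_sub, map_mul, map_mul]
      rw [dehom_X_self] at h1 ⊢
      linear_combination h2 - φ.dehom 2 (X 3) * h1)
  -- The valuation is one exactly when the reduction of `X 3 F₁ - X 2 G₁` does not vanish on the
  -- line.
  have hval : polyVal (X 3 * restrictLine φ.F - X 2 * restrictLine φ.G) = 1 ↔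
      red (X 3 * F₁ - X 2 * G₁) ∉ Ideal.span {red (X 1), red (X 0)} := by
    rw [hpoly, polyVal_C_mul_eq_one_iff ht, ← red_eq_zero_iff ht.maximalIdeal_eq,
      red_restrictLine, restrictLine_eq_zero_iff, map_X, map_X, Set.pair_comm]
  rw [hval, ← hN]
  refine ⟨fun h z _ => h z, fun h => ?_⟩
  have hQ : zeroVar 2 (X 1 ^ 2 + X 0 * X 3 : MvPolynomial (Fin 4) (IsLocalRing.ResidueField R)) =
      X 1 ^ 2 + X 0 * X 3 := by
    rw [map_add, map_mul, map_pow, zeroVar_X_of_ne, zeroVar_X_of_ne, zeroVar_X_of_ne] <;> decide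
  have hconic : (Ideal.span {X 2, X 1 ^ 2 + X 0 * X 3} :
      Ideal (MvPolynomial (Fin 4) (IsLocalRing.ResidueField R))).IsPrime :=
    isPrime_span_X_pair hQ (prime_sq_add_mul (by decide) (by decide))
  have hX0 : X 0 ∉ (Ideal.span {X 2, X 1 ^ 2 + X 0 * X 3} :
      Ideal (MvPolynomial (Fin 4) (IsLocalRing.ResidueField R))) :=
    notMem_span_pair_of_eval (Pi.single 0 1) (by simp) (by simp) (by simp)
  have hQhom : (X 1 ^ 2 + X 0 * X 3 : MvPolynomial (Fin 4) R).IsHomogeneous 2 :=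
    ((hX 1).pow 2).add ((hX 0).mul (hX 3))
  have hred : red (X 1 ^ 2 + X 0 * X 3 : MvPolynomial (Fin 4) R) = X 1 ^ 2 + X 0 * X 3 := by simp
  refine schemeNormal_of_isPrimaryPiece ht hcoprime hsmooth hL
    (.of_isPrime (P := Ideal.span {red (X 2), red (X 1 ^ 2 + X 0 * X 3)}) ?_ ?_ ?_ ?_) ?_ h ?_
  · rw [hred, map_X]; exact hconic
  · exact isHomogeneous_span_pair ((hX 2).map _) (hQhom.map _)
  · rw [hF, map_X]
    exact Ideal.mul_mem_left _ _ (Ideal.subset_span (by simp))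
  · rw [hG, hred]
    exact Ideal.subset_span (by simp)
  · rw [hF, hG, hred, map_X, map_X, map_X]
    rintro c ⟨hc₁, hc₂⟩
    obtain ⟨a, b, rfl⟩ := Ideal.mem_span_pair.mp hc₁
    -- Subtracting `a` times the conic leaves a multiple of `X 0`, which is nonzero on the conic; so
    -- the cofactor lies in the conic's ideal, and `X 0` times it in the ideal of the special fibre.
    have hmem : (b - a * X 3) * X 0 ∈ (Ideal.span {X 2, X 1 ^ 2 + X 0 * X 3} :
        Ideal (MvPolynomial (Fin 4) (IsLocalRing.ResidueField R))) := by
      rw [show (b - a * X 3) * X 0 = (a * X 1 ^ 2 + b * X 0) - a * (X 1 ^ 2 + X 0 * X 3) by ring]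
      exact sub_mem hc₂ (Ideal.mul_mem_left _ _ (Ideal.subset_span (by simp)))
    obtain ⟨d, e, hde⟩ := Ideal.mem_span_pair.mp ((hconic.mem_or_mem hmem).resolve_right hX0)
    exact Ideal.mem_span_pair.mpr ⟨d, a + e * X 0, by linear_combination X 0 * hde⟩
  -- On `X 0 = 1` both generators of the conic's ideal are multiples of `t`, by `F = 0` and `G = 0`.
  · refine forall_schemeNormalAt_of_dvd (j := 0) (hX 2) hQhom ht.maximalIdeal_eq (htnz 0) ?_
      ⟨-φ.dehom 0 F₁, ?_⟩ ⟨-φ.dehom 0 G₁, ?_⟩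
    · rw [hred, map_X]; exact hX0
    · have := eF 0
      rw [dehom_X_self] at this
      linear_combination this
    · simp only [map_add, map_mul, map_pow]
      linear_combination eG 0

theorem schemeNormal_iff_of_doubleConic (ht : Irreducible t)
    (hcoprime : IsRelPrime φ.redF φ.redG) (hsmooth : Smooth (φ.fiberStructureMap K))
    (hF : φ.redF = X 0 ^ 2) (hG : φ.redG = X 1 ^ 2 + X 2 * X 3) :
    SchemeNormal φ.scheme ↔
      ¬ ∃ μ : R, C (t ^ 2) ∣ restrictPlane φ.F - C μ * (X 1 ^ 2 + X 2 * X 3) := by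
  have hX := isHomogeneous_X R (σ := Fin 4)
  obtain ⟨F₁, hF₁, hF'⟩ := exists_isHomogeneous_eq_add ht φ.hF ((hX 0).pow 2)
    (by rw [map_pow, map_X]; exact hF)
  have hQhom : (X 1 ^ 2 + X 2 * X 3 : MvPolynomial (Fin 4) R).IsHomogeneous 2 :=
    ((hX 1).pow 2).add ((hX 2).mul (hX 3))
  have hred : red (X 1 ^ 2 + X 2 * X 3 : MvPolynomial (Fin 4) R) = X 1 ^ 2 + X 2 * X 3 := by simp
  obtain ⟨G₁, hG₁, hG'⟩ := exists_isHomogeneous_eq_add ht φ.hG hQhom (by rw [hred]; exact hG)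
  have hQ : zeroVar 0 (X 1 ^ 2 + X 2 * X 3 : MvPolynomial (Fin 4) (IsLocalRing.ResidueField R)) =
      X 1 ^ 2 + X 2 * X 3 := by
    rw [map_add, map_mul, map_pow, zeroVar_X_of_ne, zeroVar_X_of_ne, zeroVar_X_of_ne] <;> decide
  have hQprime : Prime (X 1 ^ 2 + X 2 * X 3 :
    MvPolynomial (Fin 4) (IsLocalRing.ResidueField R)) := prime_sq_add_mul (by decide) (by decide)
  have hxp : Prime (red (X 0 : MvPolynomial (Fin 4) R)) := by rw [map_X]; exact X_prime
  have hxy : ¬ red (X 0 : MvPolynomial (Fin 4) R) ∣ red (X 1 ^ 2 + X 2 * X 3) := by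
    rw [hred, map_X]
    rintro ⟨c, hc⟩
    have := congrArg (zeroVar 0) hc
    rw [hQ, map_mul, zeroVar_X_self, zero_mul] at this
    exact hQprime.ne_zero this
  have hI : φ.IsPrimaryPiece (Ideal.span {red (X 0), red (X 1 ^ 2 + X 2 * X 3)})
      (Ideal.span {red (X 0) ^ 2, red (X 1 ^ 2 + X 2 * X 3)}) := by
    refine .of_prime ((hX 0).map _) (hQhom.map _) hxp hxy ?_ ?_ ?_
    · rw [hred, map_X]; exact isPrime_span_X_pair hQ hQprime
    · rw [hF, map_X]; exact Ideal.subset_span (by simp)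
    · rw [hG, hred]; exact Ideal.subset_span (by simp)
  have htnz := φ.chartScalar_mem_nonZeroDivisors ht.ne_zero ht.maximalIdeal_eq hcoprime
  have eF := φ.dehom_F 2
  have eG := φ.dehom_G 2
  rw [hF'] at eF
  rw [hG'] at eG
  -- Here `H = -F₁`, since `F = 0` reads `X 0 ^ 2 = -t F₁`.
  have hN := forall_schemeNormalAt_iff_of_sq_eq (j := 2) (hX 0) hQhom hF₁.neg hxp hxy hI
    ht.maximalIdeal_eq (htnz 2)
    (by
      rw [hred, map_X]
      exact notMem_span_pair_of_eval (Pi.single 2 1) (by simp) (by simp) (by simp))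
    ⟨-φ.dehom 2 G₁, by
      rw [map_add, map_mul, dehom_C] at eG
      linear_combination eG⟩
    (by
      rw [map_add, map_mul, dehom_C, map_pow] at eF
      rw [map_neg]
      linear_combination eF)
  have hplane : restrictPlane φ.F = C t * restrictPlane F₁ := by
    rw [hF']
    simp [restrictPlane]
  have hF₁hom : (restrictPlane F₁).IsHomogeneous 2 := by
    have := hF₁.aeval (![0, X 1, X 2, X 3] : Fin 4 → MvPolynomial (Fin 4) R) (n := 1) (fun i => by
      fin_cases i
      · exact isHomogeneous_zero _ _ _
      · exact hX 1
      · exact hX 2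
      · exact hX 3)
    rwa [one_mul] at this
  have hcond : (∃ μ : R, C (t ^ 2) ∣ restrictPlane φ.F - C μ * (X 1 ^ 2 + X 2 * X 3)) ↔
      red (-F₁) ∈ Ideal.span {red (X 0), red (X 1 ^ 2 + X 2 * X 3)} := by
    rw [map_neg, neg_mem_iff, hred, map_X, mem_span_X_pair_iff hQ, ← restrictPlane_eq_zeroVar,
      ← red_restrictPlane, hplane, pow_two, C_mul]
    have ht0 : (C t : MvPolynomial (Fin 4) R) ≠ 0 := C_ne_zero.mpr ht.ne_zero
    constructor
    · rintro ⟨μ, c, hc⟩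
      -- The restriction of `F` to the plane is divisible by `t`, and the conic is nonzero modulo
      -- `t`, so `t` divides `μ`.
      have h0 : red (C μ * (X 1 ^ 2 + X 2 * X 3)) = 0 := by
        refine (red_eq_zero_iff ht.maximalIdeal_eq _).mpr ⟨restrictPlane F₁ - C t * c, ?_⟩
        linear_combination -hc
      rw [map_mul, hred] at h0
      have hμ := (mul_eq_zero.mp h0).resolve_right hQprime.ne_zero
      rw [red_eq_zero_iff ht.maximalIdeal_eq] at hμ
      obtain ⟨r, hr⟩ := hμ
      have heq : restrictPlane F₁ = r * (X 1 ^ 2 + X 2 * X 3) + C t * c := by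
        refine mul_left_cancel₀ ht0 ?_
        linear_combination hc + (X 1 ^ 2 + X 2 * X 3) * hr
      refine ⟨red r, ?_⟩
      rw [heq, map_add, map_mul red r, hred,
        (red_eq_zero_iff ht.maximalIdeal_eq (C t * c)).mpr (dvd_mul_right _ _), add_zero, mul_comm]
    · intro hdvd
      -- Both forms have degree 2, so the quotient is a constant; its lift `r` gives `μ = t * r`.
      obtain ⟨c, hc⟩ := exists_eq_C_mul_of_dvd (hF₁hom.map _) (hred ▸ hQhom.map _) hdvd
      obtain ⟨r, rfl⟩ := IsLocalRing.residue_surjective c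
      obtain ⟨d, hd⟩ := exists_eq_add_of_red_eq ht.maximalIdeal_eq
        (a := restrictPlane F₁) (b := C r * (X 1 ^ 2 + X 2 * X 3))
        (by rw [map_mul, hred, map_C]; exact hc)
      refine ⟨t * r, d, ?_⟩
      rw [hd, C_mul]
      ring
  rw [hcond, ← hN]
  refine ⟨fun h z _ => h z, fun h => schemeNormal_of_isPrimaryPiece ht hcoprime hsmooth hI hI ?_ h h⟩
  rw [inf_idem, hF, hG, hred, map_X]

end Normal

end QuadricPair

/-! ### The multiple line. -/

namespace QuadricPair

attribute [local instance] MvPolynomial.gradedAlgebra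

section MultipleLine

variable {R : Type u} [CommRing R] [IsDomain R] [IsDiscreteValuationRing R] {φ : QuadricPair R}
  {t : R}

/-- The prime `p` built from `(X 0, X 1)` lies on the line, so `ξ` specialises to it and is in the
same chart, with prime `q ≤ p`. Since `q` contains `t`, `X 0` and `X 1`, which generate `p`, the two
agree. -/
theorem exists_liesOver_of_isGenericPoint (ht : Irreducible t)
    (hF : φ.redF ∈ Ideal.span {X 0, X 1}) (hG : φ.redG ∈ Ideal.span {X 0, X 1})
    (ξ : φ.specialFiber) (hξ : IsGenericPoint ξ (φ.specialFiberTo ⁻¹' φ.lineLocus)) :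
    ∃ p : Spec (CommRingCat.of (φ.Chart 2)), φ.chartMap 2 p = φ.specialFiberTo ξ ∧
      φ.LiesOver 2 p.asIdeal (Ideal.span {X 0, X 1}) := by
  have hX := isHomogeneous_X R (σ := Fin 4)
  have hprim := IsPrimaryPiece.of_isPrime isPrime_span_X_zero_X_one
    (isHomogeneous_span_pair (isHomogeneous_X _ 0) (isHomogeneous_X _ 1)) hF hG
  obtain ⟨p, hp, hpL⟩ := hprim.exists_liesOver 2
    (notMem_span_pair_of_eval (Pi.single 2 1) (by simp) (by simp) (by simp))
  obtain ⟨ζ, hζ⟩ := (φ.mem_range_specialFiberTo_iff 2 p ht.maximalIdeal_eq).mpr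
    (hpL.scalar_mem ht.maximalIdeal_eq)
  have hmem : ∀ i : Fin 4, i = 0 ∨ i = 1 → X i ∈ φ.pointIdeal (φ.chartMap 2 p) := by
    intro i hi
    rw [hp, Ideal.mem_comap, map_X]
    rcases hi with rfl | rfl <;> exact Ideal.subset_span (by simp)
  have hζL : ζ ∈ φ.specialFiberTo ⁻¹' φ.lineLocus := by
    change φ.specialFiberTo ζ ∈ φ.lineLocus
    rw [hζ]
    exact hmem
  have hspec : φ.specialFiberTo ξ ⤳ φ.chartMap 2 p := by
    rw [← hζ]
    exact (hξ.specializes hζL).map φ.specialFiberTo.continuous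
  obtain ⟨q, hq⟩ : φ.specialFiberTo ξ ∈ Set.range (φ.chartMap 2) :=
    hspec.mem_open (φ.chartMap 2).isOpenEmbedding.isOpen_range ⟨p, rfl⟩
  have hle : q.asIdeal ≤ p.asIdeal := by
    rw [← hq, (φ.chartMap 2).isOpenEmbedding.isInducing.specializes_iff] at hspec
    exact (PrimeSpectrum.le_iff_specializes q p).mpr hspec
  have hξL : ξ ∈ φ.specialFiberTo ⁻¹' φ.lineLocus := hξ.mem
  have hqX : ∀ i : Fin 4, i = 0 ∨ i = 1 → φ.dehom 2 (X i) ∈ q.asIdeal := by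
    intro i hi
    rw [← φ.mem_pointIdeal_chartMap_iff 2 q (hX i), hq]
    exact hξL i hi
  have hqt : φ.chartScalar 2 t ∈ q.asIdeal :=
    (φ.mem_range_specialFiberTo_iff 2 q ht.maximalIdeal_eq).mp ⟨ξ, hq.symm⟩
  have heq : q.asIdeal = p.asIdeal := by
    refine le_antisymm hle ?_
    rw [hpL.eq_span ht.maximalIdeal_eq (T := {X 0, X 1})
      (by rintro _ (rfl | rfl); exacts [⟨_, hX 0⟩, ⟨_, hX 1⟩])
      (by rw [Set.image_pair, map_X, map_X]), Set.image_pair, Ideal.span_le]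
    rintro _ (rfl | rfl | rfl)
    exacts [hqt, hqX 0 (Or.inl rfl), hqX 1 (Or.inr rfl)]
  refine ⟨q, hq, ?_⟩
  rw [heq]
  exact hpL

theorem exists_eq_add_of_mem_span_sq (ht : Irreducible t) {f : MvPolynomial (Fin 4) R} {n : ℕ}
    (hf : f.IsHomogeneous n) (h : red f ∈ Ideal.span {X 0, X 1} ^ 2) :
    ∃ a c : MvPolynomial (Fin 4) R, a ∈ Ideal.span {X 0, X 1} ^ 2 ∧ c.IsHomogeneous n ∧
      f = a + C t * c := by
  have hmap : Ideal.span {X 0, X 1} ^ 2 =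
      ((Ideal.span {X 0, X 1} : Ideal (MvPolynomial (Fin 4) R)) ^ 2).map red := by
    rw [Ideal.map_pow, Ideal.map_span, Set.image_pair, map_X, map_X]
  rw [hmap, Ideal.mem_map_iff_of_surjective _ red_surjective] at h
  obtain ⟨a, ha, hred⟩ := h
  obtain ⟨c, hc⟩ := exists_eq_add_of_red_eq ht.maximalIdeal_eq hred.symm
  have hhom : ((Ideal.span {X 0, X 1} : Ideal (MvPolynomial (Fin 4) R)) ^ 2).IsHomogeneous
      (homogeneousSubmodule (Fin 4) R) := by
    have h1 : (Ideal.span {X 0, X 1} : Ideal (MvPolynomial (Fin 4) R)).IsHomogeneous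
        (homogeneousSubmodule (Fin 4) R) := Ideal.homogeneous_span _ _ (by
      rintro _ (rfl | rfl)
      exacts [⟨_, isHomogeneous_X R 0⟩, ⟨_, isHomogeneous_X R 1⟩])
    rw [pow_two]
    exact h1.mul h1
  -- A lift from the squared ideal need not be homogeneous; its component of degree `n` stays in
  -- that homogeneous ideal.
  refine ⟨homogeneousComponent n a, homogeneousComponent n c,
    homogeneousComponent_mem_of_mem hhom ha n, homogeneousComponent_isHomogeneous n c, ?_⟩
  have := congrArg (homogeneousComponent n) hc
  rwa [homogeneousComponent_eq_self hf, map_add, homogeneousComponent_C_mul] at this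

/-- Write `F = a + t F₁` with `a` in `(X 0, X 1) ^ 2`. Valuation one says that `F₁` is a unit at
`p`, so `F = 0` puts `t` in `p ^ 2` locally. Then `G = 0` expresses `X 0` by `X 1` modulo `p ^ 2`,
so `X 1` generates. -/
theorem schemeNormalAt_of_multipleLine (ht : Irreducible t)
    (hcoprime : IsRelPrime φ.redF φ.redG)
    {q q' : MvPolynomial (Fin 2) (IsLocalRing.ResidueField R)} {μ : IsLocalRing.ResidueField R}
    (hq : q.IsHomogeneous 2) (hq' : q'.IsHomogeneous 2) (hF : φ.redF = rename ![0, 1] q)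
    (hG : φ.redG = X 0 * X 2 + C μ * (X 1 * X 3) + rename ![0, 1] q')
    (ξ : φ.specialFiber) (hξ : IsGenericPoint ξ (φ.specialFiberTo ⁻¹' φ.lineLocus))
    (hval : polyVal (restrictLine φ.F) = 1) :
    SchemeNormalAt φ.scheme (φ.specialFiberTo ξ) := by
  have hX := isHomogeneous_X R (σ := Fin 4)
  have hqL := hq.rename_mem_span_pair_sq
  have hqL' := hq'.rename_mem_span_pair_sq
  obtain ⟨a, F₁, ha, hF₁, hF'⟩ := exists_eq_add_of_mem_span_sq ht φ.hF (f := φ.F) (by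
    change φ.redF ∈ _
    rw [hF]
    exact hqL)
  obtain ⟨m, rfl⟩ := IsLocalRing.residue_surjective μ
  have hhom : (φ.G - (X 0 * X 2 + C m * (X 1 * X 3))).IsHomogeneous 2 := by
    refine φ.hG.sub (((hX 0).mul (hX 2)).add ?_)
    simpa using (isHomogeneous_C (Fin 4) m).mul ((hX 1).mul (hX 3))
  obtain ⟨b, G₁, hb, hG₁, hG'⟩ := exists_eq_add_of_mem_span_sq ht hhom (by
    have h1 : red (φ.G - (X 0 * X 2 + C m * (X 1 * X 3))) = rename ![0, 1] q' := by
      have h2 : red φ.G = φ.redG := rfl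
      rw [map_sub, h2, hG]
      simp
    rw [h1]
    exact hqL')
  have hFL : φ.redF ∈ Ideal.span {X 0, X 1} := by
    rw [hF]; exact Ideal.pow_le_self two_ne_zero hqL
  have hGL : φ.redG ∈ Ideal.span {X 0, X 1} := by
    rw [hG]
    refine add_mem (add_mem ?_ ?_) (Ideal.pow_le_self two_ne_zero hqL')
    · exact Ideal.mul_mem_right _ _ (Ideal.subset_span (by simp))
    · exact Ideal.mul_mem_left _ _ (Ideal.mul_mem_right _ _ (Ideal.subset_span (by simp)))
  obtain ⟨p, hp, hpL⟩ := exists_liesOver_of_isGenericPoint ht hFL hGL ξ hξ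
  have hprime : p.asIdeal.IsPrime := p.isPrime
  have h1 : (1 : φ.Chart 2) ∉ p.asIdeal := (Ideal.ne_top_iff_one _).mp hprime.ne_top
  have hF₁p : φ.dehom 2 F₁ ∉ p.asIdeal := by
    have ha0 : restrictLine a = 0 :=
      restrictLine_eq_zero_iff.mpr (Ideal.pow_le_self two_ne_zero ha)
    have hline : restrictLine φ.F = C t * restrictLine F₁ := by
      rw [restrictLine] at ha0
      rw [hF', restrictLine, restrictLine, map_add, ha0, zero_add, map_mul, algHom_C]
      rfl
    rw [hline, polyVal_C_mul_eq_one_iff ht, ← red_eq_zero_iff ht.maximalIdeal_eq,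
      red_restrictLine, restrictLine_eq_zero_iff] at hval
    rwa [hpL hF₁]
  have hXp : ∀ i : Fin 4, i = 0 ∨ i = 1 → φ.dehom 2 (X i) ∈ p.asIdeal := by
    intro i hi
    rw [hpL (hX i), map_X]
    rcases hi with rfl | rfl <;> exact Ideal.subset_span (by simp)
  have hsq : ∀ c ∈ (Ideal.span {X 0, X 1} : Ideal (MvPolynomial (Fin 4) R)) ^ 2,
      φ.dehom 2 c ∈ p.asIdeal ^ 2 := by
    intro c hc
    have h2 := Ideal.mem_map_of_mem (φ.dehom 2) hc
    rw [Ideal.map_pow] at h2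
    refine Ideal.pow_right_mono ?_ 2 h2
    rw [Ideal.map_span, Set.image_pair, Ideal.span_le]
    rintro _ (rfl | rfl)
    exacts [hXp 0 (Or.inl rfl), hXp 1 (Or.inr rfl)]
  have eF := φ.dehom_F 2
  have eG := φ.dehom_G 2
  rw [hF', map_add, map_mul, dehom_C] at eF
  rw [show φ.G = X 0 * X 2 + C m * (X 1 * X 3) + b + C t * G₁ by linear_combination hG'] at eG
  simp only [map_add, map_mul, dehom_C, dehom_X_self, mul_one] at eG
  have hspan := hpL.eq_span ht.maximalIdeal_eq (T := {X 0, X 1})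
    (by rintro _ (rfl | rfl); exacts [⟨_, hX 0⟩, ⟨_, hX 1⟩])
    (by rw [Set.image_pair, map_X, map_X])
  rw [Set.image_pair] at hspan
  rw [← hp, schemeNormalAt_chartMap_iff]
  refine normalAtPrime_of_forall_exists
    (φ.chartScalar_mem_nonZeroDivisors ht.ne_zero ht.maximalIdeal_eq hcoprime 2)
    (hpL.scalar_mem ht.maximalIdeal_eq) (hXp 1 (Or.inr rfl)) hspan ?_
  rintro _ (rfl | rfl | rfl)
  · refine ⟨_, hF₁p, Ideal.mem_sup_right ?_⟩
    rw [show φ.dehom 2 F₁ * φ.chartScalar 2 t = -φ.dehom 2 a by linear_combination eF]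
    exact neg_mem (hsq a ha)
  · refine ⟨_, hF₁p, ?_⟩
    -- Multiplying `G = 0` by `F₁` allows `t F₁` to be replaced by `-a`, which leaves a multiple of
    -- `X 1` plus terms in `p ^ 2`.
    rw [show φ.dehom 2 F₁ * φ.dehom 2 (X 0) =
      (-(φ.dehom 2 F₁ * φ.chartScalar 2 m * φ.dehom 2 (X 3))) * φ.dehom 2 (X 1) +
      (φ.dehom 2 G₁ * φ.dehom 2 a - φ.dehom 2 F₁ * φ.dehom 2 b) by
        linear_combination φ.dehom 2 F₁ * eG - φ.dehom 2 G₁ * eF]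
    refine add_mem (Ideal.mem_sup_left (Ideal.mul_mem_left _ _ (Ideal.mem_span_singleton_self _)))
      (Ideal.mem_sup_right (sub_mem ?_ ?_))
    · exact Ideal.mul_mem_left _ _ (hsq a ha)
    · exact Ideal.mul_mem_left _ _ (hsq b hb)
  · exact ⟨1, h1, Ideal.mem_sup_left (by
      rw [one_mul]; exact Ideal.mem_span_singleton_self _)⟩

end MultipleLine

end QuadricPair

theorem mainTheorem9 {R : Type u} [CommRing R] [IsDomain R] [IsDiscreteValuationRing R]
    [HenselianLocalRing R] [IsAlgClosed (IsLocalRing.ResidueField R)]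
    {K : Type u} [Field K] [Algebra R K] [IsFractionRing R K]
    (t : R) (ht : Irreducible t) (φ : QuadricPair R)
    (hcoprime : IsRelPrime φ.redF φ.redG)
    (hsmooth : Smooth (φ.fiberStructureMap K)) :
    -- (i) normality at the components of multiplicity one
    (∀ Γ ∈ irreducibleComponents φ.specialFiber, ∀ ξ : φ.specialFiber, IsGenericPoint ξ Γ →
      lengthAt φ.specialFiber ξ = 1 → SchemeNormalAt φ.scheme (φ.specialFiberTo ξ)) ∧
    -- (ii) conic and double line
    (φ.redF = X 0 * X 2 → φ.redG = X 1 ^ 2 + X 0 * X 3 →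
      (SchemeNormal φ.scheme ↔
        polyVal (X 3 * restrictLine φ.F - X 2 * restrictLine φ.G) = 1)) ∧
    -- (iii) double conic
    (φ.redF = X 0 ^ 2 → φ.redG = X 1 ^ 2 + X 2 * X 3 →
      (SchemeNormal φ.scheme ↔
        ¬ ∃ μ : R, C (t ^ 2) ∣ restrictPlane φ.F - C μ * (X 1 ^ 2 + X 2 * X 3))) ∧
    -- (iv) the multiple line `x₁ = x₂ = 0`
    (∀ (q q' : MvPolynomial (Fin 2) (IsLocalRing.ResidueField R))
        (μ : IsLocalRing.ResidueField R),
      q.IsHomogeneous 2 → q'.IsHomogeneous 2 → (μ = 0 ∨ μ = 1) →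
      φ.redF = rename ![0, 1] q →
      φ.redG = X 0 * X 2 + C μ * (X 1 * X 3) + rename ![0, 1] q' →
      ∀ Γ ∈ irreducibleComponents φ.specialFiber, Γ = φ.specialFiberTo ⁻¹' φ.lineLocus →
      ∀ ξ : φ.specialFiber, IsGenericPoint ξ Γ → 2 ≤ lengthAt φ.specialFiber ξ →
      polyVal (restrictLine φ.F) = 1 →
      SchemeNormalAt φ.scheme (φ.specialFiberTo ξ)) := by
  refine ⟨fun _ _ ξ _ hξ => QuadricPair.schemeNormalAt_of_lengthAt_eq_one ht hcoprime ξ hξ,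
    QuadricPair.schemeNormal_iff_of_conic_doubleLine ht hcoprime hsmooth,
    QuadricPair.schemeNormal_iff_of_doubleConic ht hcoprime hsmooth, ?_⟩
  rintro q q' μ hq hq' - hF hG Γ - rfl ξ hξ - hval
  exact QuadricPair.schemeNormalAt_of_multipleLine ht hcoprime hq hq' hF hG ξ hξ hval
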